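/- **Setting.** Let $M$ be a non-empty smooth (Hausdorff) $2$-manifold with a smooth affine connection $D$ (torsion is allowed) and a smooth nowhere vanishing $2$-form $\Omega$ with $D\Omega=0$; orient $M$ by $\Omega$ and write $[v,w]:=\Omega(v,w)$. For a smooth curve $\gamma$ in $M$ put $\dot\gamma=d\gamma/dt$, $\ddot\gamma=D_t\dot\gamma$, $\gamma^{(3)}=D_t\ddot\gamma$, $\gamma^{(4)}=D_t\gamma^{(3)}$. A smooth regular curve $\gamma:(-\delta,\delta)\to M$, $\delta>0$, has a *generic inflection point* at $t=0$ if $[\dot\gamma(0),\ddot\gamma(0)]=0$ and $[\dot\gamma(0),\gamma^{(3)}(0)]\neq0$. Put $$s_A(t)=\int_0^t\bigl|[\dot\gamma(u),\ddot\gamma(u)]\bigr|^{1/3}du,\qquad \tau(t)=\operatorname{sgn}(t)\,|s_A(t)|^{3/4},$$ $$\kappa_A=\frac{3[\dot\gamma,\ddot\gamma][\dot\gamma,\gamma^{(4)}]+12[\dot\gamma,\ddot\gamma][\ddot\gamma,\gamma^{(3)}]-5[\dot\gamma,\gamma^{(3)}]^2}{9\,\bigl|[\dot\gamma,\ddot\gamma]\bigr|^{8/3}}\quad\text{where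 }[\dot\gamma,\ddot\gamma]\ne0,$$ $$\mu_I=\operatorname{sgn}[\dot\gamma(0),\gamma^{(3)}(0)]\;\frac{[\dot\gamma(0),\gamma^{(4)}(0)]-6[\ddot\gamma(0),\gamma^{(3)}(0)]}{\bigl|[\dot\gamma(0),\gamma^{(3)}(0)]\bigr|^{5/4}}.$$ **Theorem 4.7.** (i) Let $\gamma:(-\delta,\delta)\to M$ have a generic inflection point at $t=0$. Then there is $\varepsilon\in(0,\delta]$ such that $[\dot\gamma,\ddot\gamma]\neq0$ for $0<|t|<\varepsilon$, the function $\tau$ is a smooth coordinate on $(-\varepsilon,\varepsilon)$ (a diffeomorphism onto an open set of $\mathbf R$), and $(s_A)^2\kappa_A$, defined for $0<|t|<\varepsilon$, extends to a $C^\infty$-function $f$ on $(-\varepsilon,\varepsilon)$, which is therefore also a $C^\infty$-function $F$ of $\tau$, $f=F\circ\tau$. Moreover $$-\frac97\left(\frac{[\dot\gamma(0),\gamma^{(4)}(0)]+[\ddot\gamma(0),\gamma^{(3)}(0)]}{[\dot\gamma(0),\gamma^{(3)}(0)]}\right)\dot f(0)+32\dot f(0)^2+9\ddot f(0)=0,$$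 $$\lim_{t\to0}(s_A)^2\kappa_A=f(0)=-\frac5{16},\qquad \lim_{t\to0}\frac{(s_A)^2\kappa_A+5/16}{\tau}=-\frac{3\sqrt[4]{3}}{28\sqrt2}\,\mu_I,$$ $$32\left(\frac{dF}{d\tau}(0)\right)^2+9\frac{d^2F}{d\tau^2}(0)=0.$$ If $t=\tau$ near $0$, then $[\dot\gamma(0),\gamma^{(4)}(0)]+[\ddot\gamma(0),\gamma^{(3)}(0)]=0$, so that the first relation reduces to $32\dot f(0)^2+9\ddot f(0)=0$. (ii) Conversely, let $f$ be a $C^\infty$-function on $(-a,a)$, $a>0$, with $f(0)=-5/16$ and $32\dot f(0)^2+9\ddot f(0)=0$. Then there are $\delta\in(0,a]$ and a smooth regular curve $\gamma:(-\delta,\delta)\to M$ with a generic inflection point at $t=0$ such that $\tau(t)=t$ for $|t|<\delta$, and $[\dot\gamma,\ddot\gamma]\ne0$ and $(s_A)^2\kappa_A=f(t)$ for $0<|t|<\delta$. -/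

import Mathlib

open scoped Manifold ContDiff Topology
open Set Filter Bundle

noncomputable section

/-- The Euclidean plane on which surfaces are modelled. -/
abbrev Plane : Type := EuclideanSpace ℝ (Fin 2)

/-- An equi-affine structure `(D, Ω)` on a surface `M`: a smooth affine connection `D` on the
tangent bundle (torsion is allowed) together with a smooth nowhere vanishing 2-form `Ω` that is
parallel with respect to `D`. The surface is oriented by `Ω`. -/
structure EquiAffineStructure (M : Type*) [TopologicalSpace M] [ChartedSpace Plane M]
    [IsManifold (𝓡 2) ∞ M] where
  /-- The connection; `D Y x v` is the covariant derivative of `Y` at `x` in the direction `v`. -/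
  D : CovariantDerivative (𝓡 2) Plane (TangentSpace (𝓡 2) : M → Type _)
  smooth_D : CovariantDerivative.ContMDiffCovariantDerivative D ∞
  /-- The area form. -/
  Ω : ∀ x : M, TangentSpace (𝓡 2) x →L[ℝ] TangentSpace (𝓡 2) x →L[ℝ] ℝ
  smooth_Ω : ContMDiff (𝓡 2) ((𝓡 2).prod 𝓘(ℝ, Plane →L[ℝ] Plane →L[ℝ] ℝ)) ∞
    (fun x ↦ TotalSpace.mk' (Plane →L[ℝ] Plane →L[ℝ] ℝ) x (Ω x))
  alternating : ∀ (x : M) (v : TangentSpace (𝓡 2) x), Ω x v v = 0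
  nonvanishing : ∀ x : M, Ω x ≠ 0
  /-- `v (Ω (X, Y)) = Ω (D_v X, Y) + Ω (X, D_v Y)`. -/
  parallel : ∀ (X Y : ∀ x : M, TangentSpace (𝓡 2) x) (x : M) (v : TangentSpace (𝓡 2) x),
    MDifferentiableAt (𝓡 2) (𝓡 2).tangent (fun y ↦ TotalSpace.mk' Plane y (X y)) x →
    MDifferentiableAt (𝓡 2) (𝓡 2).tangent (fun y ↦ TotalSpace.mk' Plane y (Y y)) x →
      mvfderiv (𝓡 2) (fun y : M ↦ Ω y (X y) (Y y)) x v
        = Ω x (D X x v) (Y x) + Ω x (X x) (D Y x v)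

namespace EquiAffineStructure

variable {M : Type*} [TopologicalSpace M] [ChartedSpace Plane M] [IsManifold (𝓡 2) ∞ M]

/-- The velocity vector of a curve. -/
def velocity (γ : ℝ → M) (t : ℝ) : TangentSpace (𝓡 2) (γ t) :=
  mfderiv 𝓘(ℝ, ℝ) (𝓡 2) γ t (1 : ℝ)

/-- The covariant derivative `D_t X` at time `t` of a vector field `X` along a curve `γ`.
In the coordinate frame `e₁, e₂` of the chart at `γ t`, if `X = ∑ Xⁱ eᵢ` along `γ`, then
`D_t X = ∑ (dXⁱ/dt) eᵢ + ∑ Xⁱ D_{dγ/dt} eᵢ`. Below `X u` is read in the tangent bundle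
trivialization at `γ t`, its derivative gives the first sum, and the second sum is the derivative
in the direction of the velocity of the vector field with the constant coefficients `Xⁱ t`. -/
def covDerivAlong (A : EquiAffineStructure M) (γ : ℝ → M)
    (X : ∀ t : ℝ, TangentSpace (𝓡 2) (γ t)) (t : ℝ) : TangentSpace (𝓡 2) (γ t) :=
  let e := trivializationAt Plane (TangentSpace (𝓡 2) : M → Type _) (γ t)
  let coord : ℝ → Plane := fun u ↦ e.continuousLinearMapAt ℝ (γ u) (X u)
  e.symmL ℝ (γ t) (deriv coord t)
    + A.D (fun q ↦ e.symmL ℝ q (coord t)) (γ t) (velocity γ t)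

/-- The derivatives of a curve: `curveDeriv γ 1` is its velocity `dγ/dt` and
`curveDeriv γ (n + 1) = D_t (curveDeriv γ n)` for `n ≥ 1`. The value at `n = 0` is not used. -/
def curveDeriv (A : EquiAffineStructure M) (γ : ℝ → M) :
    ℕ → ∀ t : ℝ, TangentSpace (𝓡 2) (γ t)
  | 0 => fun _ ↦ 0
  | 1 => velocity γ
  | n + 2 => A.covDerivAlong γ (A.curveDeriv γ (n + 1))

/-- `bracket γ i j t = [γ⁽ⁱ⁾(t), γ⁽ʲ⁾(t)]`, where `[v, w] = Ω(v, w)`. -/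
def bracket (A : EquiAffineStructure M) (γ : ℝ → M) (i j : ℕ) (t : ℝ) : ℝ :=
  A.Ω (γ t) (A.curveDeriv γ i t) (A.curveDeriv γ j t)

/-- `γ` restricted to `(-δ, δ)` is a smooth regular curve, and `t = 0` is a generic inflection
point of it. -/
structure IsGenericInflection (A : EquiAffineStructure M) (γ : ℝ → M) (δ : ℝ) : Prop where
  pos : 0 < δ
  smooth : ContMDiffOn 𝓘(ℝ, ℝ) (𝓡 2) ∞ γ (Ioo (-δ) δ)
  regular : ∀ t ∈ Ioo (-δ) δ, velocity γ t ≠ 0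
  inflection : A.bracket γ 1 2 0 = 0
  generic : A.bracket γ 1 3 0 ≠ 0

/-- The affine arclength measured from `t = 0` (negative for negative `t`). -/
def arclength (A : EquiAffineStructure M) (γ : ℝ → M) (t : ℝ) : ℝ :=
  ∫ u in (0 : ℝ)..t, |A.bracket γ 1 2 u| ^ (1 / 3 : ℝ)

/-- The affine curvature function; meaningful where `[γ⁽¹⁾, γ⁽²⁾] ≠ 0`. -/
def curvature (A : EquiAffineStructure M) (γ : ℝ → M) (t : ℝ) : ℝ :=
  (3 * A.bracket γ 1 2 t * A.bracket γ 1 4 t + 12 * A.bracket γ 1 2 t * A.bracket γ 2 3 t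
      - 5 * A.bracket γ 1 3 t ^ 2) / (9 * |A.bracket γ 1 2 t| ^ (8 / 3 : ℝ))

/-- The normalized affine curvature; meaningful where `[γ⁽¹⁾, γ⁽²⁾] ≠ 0`. -/
def normalizedCurvature (A : EquiAffineStructure M) (γ : ℝ → M) (t : ℝ) : ℝ :=
  A.arclength γ t ^ 2 * A.curvature γ t

/-- The 3/4-arclength parameter. -/
def threeQuarterArclength (A : EquiAffineStructure M) (γ : ℝ → M) (t : ℝ) : ℝ :=
  Real.sign t * |A.arclength γ t| ^ (3 / 4 : ℝ)

/-- The affine inflectional curvature of a generic inflection point at `t = c`. -/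
def inflectionalCurvature (A : EquiAffineStructure M) (γ : ℝ → M) (c : ℝ) : ℝ :=
  Real.sign (A.bracket γ 1 3 c) * ((A.bracket γ 1 4 c - 6 * A.bracket γ 2 3 c)
    / |A.bracket γ 1 3 c| ^ (5 / 4 : ℝ))

end EquiAffineStructure

end

/-! Put `p = [γ', γ'']` and `q = [γ'', γ⁽³⁾]`. Since `Ω` is parallel, brackets obey the product
rule, so `p' = [γ', γ⁽³⁾]`, `p'' = [γ', γ⁽⁴⁾] + q`, `q' = [γ'', γ⁽⁴⁾]`, and the numerator of the
curvature is `N = 3pp'' + 9pq - 5p'²`. At the inflection point `γ''` is a multiple of `γ'`, which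
gives one further identity, `p' q' = (p'' - q) q` at `0`. These facts are all that the direct half
needs from the surface.

A generic inflection is a simple zero of `p`, so `p = ± t h³` with `h` smooth and positive near `0`.
The substitution `u = t v` turns the arclength integral into `t |t|^(1/3) H(t)` with `H` smooth.
Hence `τ = t H^(3/4)` is a smooth coordinate, and in `s_A² κ_A` the powers of `|t|` cancel, leaving
`H² N / (9 h⁸)`. The limits and the quadratic relation follow by comparing two-jets at `0`: `h''(0)`
drops out, and the identity for `q'(0)` eliminates the only other second order unknown
(`exists_smooth_normalizedCurvature`, `normalizedCurvature_expansion`). Passing to `τ` removes the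
linear term of the relation, because `7 p' τ'' = τ' p''` at `0`.

Conversely, a frame `(γ', E)` with `D_t γ' = c γ' + (4/3)³ t E`, `D_t E = x γ' - c E` exists by
solving an ODE in a chart (`exists_curve_of_structure_equations`). The system is trace-free, so
`[γ', E] = 1` persists and `p = (4/3)³ t`, which forces `τ = t`. The normalized curvature is then
`-5/16 + (9/16)(c t - c² t²) - (4/3) t³ x`. Its two-jet is exactly of the prescribed kind, with `c`
free, and the smooth function `x` absorbs any remainder of order three
(`exists_contDiff_structure_coefficient`). -/

noncomputable section

/-! ### Vector fields and fields along curves in a tangent bundle trivialization -/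

namespace EquiAffineStructure

variable {M : Type*} [TopologicalSpace M] [ChartedSpace Plane M] [IsManifold (𝓡 2) ∞ M]

/-- The vector field with constant coefficients `c` in the tangent bundle trivialization at `x₀`. -/
def constField (x₀ : M) (c : Plane) (q : M) : TangentSpace (𝓡 2) q :=
  (trivializationAt Plane (TangentSpace (𝓡 2) : M → Type _) x₀).symmL ℝ q c

/-- The coefficients of a tangent vector in the tangent bundle trivialization at `x₀`. -/
def coeffs (x₀ q : M) : TangentSpace (𝓡 2) q →L[ℝ] Plane :=
  (trivializationAt Plane (TangentSpace (𝓡 2) : M → Type _) x₀).continuousLinearMapAt ℝ q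

/-- The set on which the trivialization at `x₀` is defined. -/
abbrev trivSet (x₀ : M) : Set M :=
  (trivializationAt Plane (TangentSpace (𝓡 2) : M → Type _) x₀).baseSet

/-- A vector field along `γ` that is smooth at `t`. -/
abbrev SmoothAlongAt (γ : ℝ → M) (X : ∀ t, TangentSpace (𝓡 2) (γ t)) (t : ℝ) : Prop :=
  ContMDiffAt 𝓘(ℝ, ℝ) (𝓡 2).tangent ∞ (fun u ↦ TotalSpace.mk' Plane (γ u) (X u)) t

/-- A vector field that is smooth at `x`. -/
abbrev SmoothFieldAt (Y : ∀ q : M, TangentSpace (𝓡 2) q) (x : M) : Prop :=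
  ContMDiffAt (𝓡 2) (𝓡 2).tangent ∞ (fun q ↦ TotalSpace.mk' Plane q (Y q)) x

/-- The tangent bundle is one degree less smooth than the manifold, and `∞ + 1 = ∞`. -/
lemma contMDiffVectorBundle_tangent :
    ContMDiffVectorBundle ∞ Plane (TangentSpace (𝓡 2) : M → Type _) (𝓡 2) :=
  have : IsManifold (𝓡 2) (∞ + 1) M := inferInstanceAs (IsManifold (𝓡 2) ∞ M)
  TangentBundle.contMDiffVectorBundle

attribute [local instance] contMDiffVectorBundle_tangent

lemma isOpen_trivSet (x₀ : M) : IsOpen (trivSet x₀) := Trivialization.open_baseSet _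

lemma mem_trivSet_self (x₀ : M) : x₀ ∈ trivSet x₀ :=
  FiberBundle.mem_baseSet_trivializationAt' x₀

lemma trivSet_eq (x₀ : M) : trivSet x₀ = (chartAt Plane x₀).source :=
  TangentBundle.trivializationAt_baseSet x₀

lemma coeffs_constField {x₀ q : M} (hq : q ∈ trivSet x₀) (c : Plane) :
    coeffs x₀ q (constField x₀ c q) = c :=
  Trivialization.continuousLinearMapAt_symmL _ hq c

lemma constField_coeffs {x₀ q : M} (hq : q ∈ trivSet x₀) (v : TangentSpace (𝓡 2) q) :
    constField x₀ (coeffs x₀ q v) q = v :=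
  Trivialization.symmL_continuousLinearMapAt _ hq v

lemma constField_add (x₀ : M) (c d : Plane) :
    constField x₀ (c + d) = constField x₀ c + constField x₀ d := by
  ext1 q; exact map_add _ c d

lemma constField_smul (x₀ : M) (r : ℝ) (c : Plane) :
    constField x₀ (r • c) = r • constField x₀ c := by
  ext1 q; exact map_smul _ r c

lemma trivializationAt_snd_eq_coeffs {x₀ q : M} (hq : q ∈ trivSet x₀) (v : TangentSpace (𝓡 2) q) :
    (trivializationAt Plane (TangentSpace (𝓡 2) : M → Type _) x₀ (TotalSpace.mk' Plane q v)).2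
      = coeffs x₀ q v := by
  rw [coeffs, Trivialization.continuousLinearMapAt_apply, Trivialization.linearMapAt_apply,
    if_pos hq]

lemma smoothAlongAt_iff {γ : ℝ → M} {X : ∀ t, TangentSpace (𝓡 2) (γ t)} {t : ℝ} {x₀ : M}
    (hx : γ t ∈ trivSet x₀) :
    SmoothAlongAt γ X t ↔ ContMDiffAt 𝓘(ℝ, ℝ) (𝓡 2) ∞ γ t ∧
      ContDiffAt ℝ ∞ (fun u ↦ coeffs x₀ (γ u) (X u)) t := by
  rw [SmoothAlongAt, Trivialization.contMDiffAt_iff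
    (e := trivializationAt Plane (TangentSpace (𝓡 2) : M → Type _) x₀)]
  · refine and_congr_right fun h ↦ ?_
    rw [← contMDiffAt_iff_contDiffAt]
    refine Filter.EventuallyEq.contMDiffAt_iff ?_
    filter_upwards [h.continuousAt.preimage_mem_nhds ((isOpen_trivSet x₀).mem_nhds hx)] with u hu
    exact trivializationAt_snd_eq_coeffs hu _
  · exact (Trivialization.mem_source _).2 hx

lemma smoothFieldAt_iff {Y : ∀ q : M, TangentSpace (𝓡 2) q} {x x₀ : M} (hx : x ∈ trivSet x₀) :
    SmoothFieldAt Y x ↔ ContMDiffAt (𝓡 2) 𝓘(ℝ, Plane) ∞ (fun q ↦ coeffs x₀ q (Y q)) x := by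
  rw [SmoothFieldAt, Trivialization.contMDiffAt_section_iff
    (trivializationAt Plane (TangentSpace (𝓡 2) : M → Type _) x₀) hx]
  refine Filter.EventuallyEq.contMDiffAt_iff ?_
  filter_upwards [(isOpen_trivSet x₀).mem_nhds hx] with q hq
  exact trivializationAt_snd_eq_coeffs hq _

lemma smoothFieldAt_constField {x x₀ : M} (hx : x ∈ trivSet x₀) (c : Plane) :
    SmoothFieldAt (constField x₀ c) x := by
  rw [smoothFieldAt_iff hx]
  refine (contMDiffAt_const (c := c)).congr_of_eventuallyEq ?_
  filter_upwards [(isOpen_trivSet x₀).mem_nhds hx] with q hq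
  exact coeffs_constField hq c

lemma SmoothAlongAt.curve {γ : ℝ → M} {X : ∀ t, TangentSpace (𝓡 2) (γ t)} {t : ℝ}
    (h : SmoothAlongAt γ X t) : ContMDiffAt 𝓘(ℝ, ℝ) (𝓡 2) ∞ γ t :=
  ((smoothAlongAt_iff (mem_trivSet_self _)).1 h).1

lemma SmoothAlongAt.congr {γ : ℝ → M} {X Z : ∀ t, TangentSpace (𝓡 2) (γ t)} {t : ℝ}
    (h : SmoothAlongAt γ X t) (hZ : ∀ᶠ u in 𝓝 t, X u = Z u) : SmoothAlongAt γ Z t := by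
  refine ContMDiffAt.congr_of_eventuallyEq h ?_
  filter_upwards [hZ] with u hu
  rw [hu]

lemma SmoothAlongAt.add {γ : ℝ → M} {X Z : ∀ t, TangentSpace (𝓡 2) (γ t)} {t : ℝ}
    (hX : SmoothAlongAt γ X t) (hZ : SmoothAlongAt γ Z t) :
    SmoothAlongAt γ (fun u ↦ X u + Z u) t := by
  rw [smoothAlongAt_iff (mem_trivSet_self _)] at *
  refine ⟨hX.1, ?_⟩
  simp_rw [map_add]
  exact hX.2.add hZ.2

lemma SmoothAlongAt.smul {γ : ℝ → M} {X : ∀ t, TangentSpace (𝓡 2) (γ t)} {t : ℝ} {f : ℝ → ℝ}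
    (hf : ContDiffAt ℝ ∞ f t) (hX : SmoothAlongAt γ X t) :
    SmoothAlongAt γ (fun u ↦ f u • X u) t := by
  rw [smoothAlongAt_iff (mem_trivSet_self _)] at *
  refine ⟨hX.1, ?_⟩
  simp_rw [map_smul]
  exact hf.smul hX.2

lemma SmoothFieldAt.along {γ : ℝ → M} {Y : ∀ q : M, TangentSpace (𝓡 2) q} {t : ℝ}
    (hγ : ContMDiffAt 𝓘(ℝ, ℝ) (𝓡 2) ∞ γ t) (hY : SmoothFieldAt Y (γ t)) :
    SmoothAlongAt γ (fun u ↦ Y (γ u)) t :=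
  ContMDiffAt.comp t hY hγ

/-- The tangent trivialization at `x₀` is the derivative of the chart at `x₀`, so this is the chain
rule. -/
lemma coeffs_velocity {γ : ℝ → M} {t : ℝ} {x₀ : M} (hx : γ t ∈ trivSet x₀)
    (hγ : MDifferentiableAt 𝓘(ℝ, ℝ) (𝓡 2) γ t) :
    coeffs x₀ (γ t) (velocity γ t) = deriv (fun u ↦ extChartAt (𝓡 2) x₀ (γ u)) t := by
  rw [trivSet_eq] at hx
  rw [coeffs, TangentBundle.continuousLinearMapAt_trivializationAt hx, velocity,
    ← fderiv_apply_one_eq_deriv, ← mfderiv_eq_fderiv]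
  have := mfderiv_comp (I := 𝓘(ℝ, ℝ)) (I' := 𝓡 2) (I'' := 𝓘(ℝ, Plane)) t
    (mdifferentiableAt_extChartAt hx) hγ
  change _ = mfderiv 𝓘(ℝ, ℝ) 𝓘(ℝ, Plane) (extChartAt (𝓡 2) x₀ ∘ γ) t (1 : ℝ)
  rw [this]
  rfl

lemma contDiffAt_infty_deriv {F : Type*} [NormedAddCommGroup F] [NormedSpace ℝ F] {f : ℝ → F}
    {t : ℝ} (hf : ContDiffAt ℝ ∞ f t) : ContDiffAt ℝ ∞ (deriv f) t := by
  have := (hf.fderiv_right (m := ∞) le_rfl).clm_apply (contDiffAt_const (c := (1 : ℝ)))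
  simpa [fderiv_apply_one_eq_deriv] using this

lemma smoothAlongAt_velocity {γ : ℝ → M} {t : ℝ}
    (hγ : ∀ᶠ u in 𝓝 t, ContMDiffAt 𝓘(ℝ, ℝ) (𝓡 2) ∞ γ u) :
    SmoothAlongAt γ (velocity γ) t := by
  have ht := hγ.self_of_nhds
  rw [smoothAlongAt_iff (mem_trivSet_self _)]
  refine ⟨ht, ?_⟩
  have h1 : ContDiffAt ℝ ∞ (fun u ↦ extChartAt (𝓡 2) (γ t) (γ u)) t := by
    rw [← contMDiffAt_iff_contDiffAt]
    exact ContMDiffAt.comp t (contMDiffAt_extChartAt) ht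
  have h2 : ContDiffAt ℝ ∞ (deriv (fun u ↦ extChartAt (𝓡 2) (γ t) (γ u))) t :=
    contDiffAt_infty_deriv h1
  refine h2.congr_of_eventuallyEq ?_
  filter_upwards [hγ, ht.continuousAt.preimage_mem_nhds
    ((isOpen_trivSet (γ t)).mem_nhds (mem_trivSet_self _))] with u hu hu'
  exact coeffs_velocity hu' (hu.mdifferentiableAt (by simp))

end EquiAffineStructure

/-! ### Calculus rules for the connection and for `D_t` -/

namespace EquiAffineStructure

variable {M : Type*} [TopologicalSpace M] [ChartedSpace Plane M] [IsManifold (𝓡 2) ∞ M]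

attribute [local instance] contMDiffVectorBundle_tangent

lemma SmoothFieldAt.mdifferentiableAt {Y : ∀ q : M, TangentSpace (𝓡 2) q} {x : M}
    (h : SmoothFieldAt Y x) :
    MDifferentiableAt (𝓡 2) (𝓡 2).tangent (fun y ↦ TotalSpace.mk' Plane y (Y y)) x :=
  ContMDiffAt.mdifferentiableAt h (by simp)

variable (A : EquiAffineStructure M)

lemma D_add {Y Z : ∀ q : M, TangentSpace (𝓡 2) q} {x : M} (hY : SmoothFieldAt Y x)
    (hZ : SmoothFieldAt Z x) : A.D (Y + Z) x = A.D Y x + A.D Z x :=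
  A.D.isCovariantDerivativeOnUniv.add hY.mdifferentiableAt hZ.mdifferentiableAt

lemma D_smul_const {Y : ∀ q : M, TangentSpace (𝓡 2) q} {x : M} (r : ℝ) (hY : SmoothFieldAt Y x) :
    A.D (r • Y) x = r • A.D Y x :=
  A.D.isCovariantDerivativeOnUniv.smul_const r hY.mdifferentiableAt

lemma D_smul {Y : ∀ q : M, TangentSpace (𝓡 2) q} {x : M} {f : M → ℝ}
    (hf : ContMDiffAt (𝓡 2) 𝓘(ℝ, ℝ) ∞ f x) (hY : SmoothFieldAt Y x) (v : TangentSpace (𝓡 2) x) :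
    A.D (f • Y) x v = f x • A.D Y x v + mvfderiv (𝓡 2) f x v • Y x := by
  rw [A.D.isCovariantDerivativeOnUniv.leibniz hY.mdifferentiableAt
    (hf.mdifferentiableAt (by simp))]
  rfl

lemma D_congr {Y Z : ∀ q : M, TangentSpace (𝓡 2) q} {x : M} (hY : SmoothFieldAt Y x)
    (hZ : SmoothFieldAt Z x) (h : ∀ᶠ q in 𝓝 x, Y q = Z q) : A.D Y x = A.D Z x :=
  A.D.isCovariantDerivativeOnUniv.congr_of_eventuallyEq hY.mdifferentiableAt hZ.mdifferentiableAt
    univ_mem h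

lemma D_constField_add {x₀ x : M} (hx : x ∈ trivSet x₀) (c d : Plane) :
    A.D (constField x₀ (c + d)) x = A.D (constField x₀ c) x + A.D (constField x₀ d) x := by
  rw [constField_add, D_add A (smoothFieldAt_constField hx c) (smoothFieldAt_constField hx d)]

lemma D_constField_smul {x₀ x : M} (hx : x ∈ trivSet x₀) (r : ℝ) (c : Plane) :
    A.D (constField x₀ (r • c)) x = r • A.D (constField x₀ c) x := by
  rw [constField_smul, D_smul_const A r (smoothFieldAt_constField hx c)]

lemma plane_eq_sum (c : Plane) :
    c = c 0 • EuclideanSpace.single 0 (1 : ℝ) + c 1 • EuclideanSpace.single 1 (1 : ℝ) := by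
  ext i; fin_cases i <;> simp

/-- The Leibniz rule in a trivialization. -/
lemma D_eq_constField {Y : ∀ q : M, TangentSpace (𝓡 2) q} {x x₀ : M} (hx : x ∈ trivSet x₀)
    (hY : SmoothFieldAt Y x) (v : TangentSpace (𝓡 2) x) :
    A.D Y x v = constField x₀ (mvfderiv (𝓡 2) (fun q ↦ coeffs x₀ q (Y q)) x v) x
      + A.D (constField x₀ (coeffs x₀ x (Y x))) x v := by
  have hc := (smoothFieldAt_iff hx).1 hY
  set g : M → Plane := fun q ↦ coeffs x₀ q (Y q) with hg
  have hgi : ∀ i, ContMDiffAt (𝓡 2) 𝓘(ℝ, ℝ) ∞ (fun q ↦ g q i) x := fun i ↦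
    ((EuclideanSpace.proj (𝕜 := ℝ) i).contDiff.contMDiff.contMDiffAt).comp x hc
  have hdi : ∀ i, mvfderiv (𝓡 2) (fun q ↦ g q i) x v = (mvfderiv (𝓡 2) g x v) i := by
    intro i
    have := mfderiv_comp (I := 𝓡 2) (I' := 𝓘(ℝ, Plane)) (I'' := 𝓘(ℝ, ℝ)) x
      ((EuclideanSpace.proj (𝕜 := ℝ) i).contDiff.contMDiff.mdifferentiableAt
        (n := ∞) (by simp) : MDifferentiableAt _ _ (EuclideanSpace.proj (𝕜 := ℝ) i) (g x))
      (hc.mdifferentiableAt (by simp))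
    change mfderiv (𝓡 2) 𝓘(ℝ, ℝ) (EuclideanSpace.proj (𝕜 := ℝ) i ∘ g) x v = _
    rw [this, mfderiv_eq_fderiv, ContinuousLinearMap.fderiv]
    rfl
  let E : Fin 2 → ∀ q : M, TangentSpace (𝓡 2) q :=
    fun i ↦ constField x₀ (EuclideanSpace.single i (1 : ℝ))
  have hE : ∀ i, SmoothFieldAt (E i) x := fun i ↦ smoothFieldAt_constField hx _
  have hgE : ∀ i, SmoothFieldAt ((fun q ↦ g q i) • E i) x := fun i ↦
    ContMDiffAt.smul_section (hgi i) (hE i)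
  have hsum : SmoothFieldAt ((fun q ↦ g q 0) • E 0 + (fun q ↦ g q 1) • E 1) x :=
    ContMDiffAt.add_section (hgE 0) (hgE 1)
  -- The connection is local, so `Y` may be replaced by its expansion in the coordinate frame, valid
  -- only near `x`.
  have h1 : A.D Y x = A.D ((fun q ↦ g q 0) • E 0 + (fun q ↦ g q 1) • E 1) x := by
    refine D_congr A hY hsum ?_
    filter_upwards [(isOpen_trivSet x₀).mem_nhds hx] with q hq
    conv_lhs => rw [← constField_coeffs hq (Y q), plane_eq_sum (coeffs x₀ q (Y q))]
    simp only [constField_add, constField_smul]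
    rfl
  have h2 : A.D (constField x₀ (g x)) x v = g x 0 • A.D (E 0) x v + g x 1 • A.D (E 1) x v := by
    conv_lhs => rw [plane_eq_sum (g x)]
    rw [D_constField_add A hx, D_constField_smul A hx, D_constField_smul A hx]
    rfl
  have h3 : constField x₀ (mvfderiv (𝓡 2) g x v) x
      = mvfderiv (𝓡 2) (fun q ↦ g q 0) x v • E 0 x + mvfderiv (𝓡 2) (fun q ↦ g q 1) x v • E 1 x := by
    rw [hdi, hdi]
    conv_lhs => rw [plane_eq_sum (mvfderiv (𝓡 2) g x v)]
    rw [constField_add, constField_smul, constField_smul]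
    rfl
  rw [h1, D_add A (hgE 0) (hgE 1), add_apply, D_smul A (hgi 0) (hE 0),
    D_smul A (hgi 1) (hE 1), h2, h3]
  abel

section Along

variable {γ : ℝ → M} {X Z : ∀ t, TangentSpace (𝓡 2) (γ t)} {t : ℝ}

lemma covDerivAlong_eq : A.covDerivAlong γ X t =
    constField (γ t) (deriv (fun u ↦ coeffs (γ t) (γ u) (X u)) t) (γ t)
      + A.D (constField (γ t) (coeffs (γ t) (γ t) (X t))) (γ t) (velocity γ t) := rfl

lemma SmoothAlongAt.differentiableAt_coeffs (h : SmoothAlongAt γ X t) :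
    DifferentiableAt ℝ (fun u ↦ coeffs (γ t) (γ u) (X u)) t :=
  ((smoothAlongAt_iff (mem_trivSet_self _)).1 h).2.differentiableAt (by simp)

lemma covDerivAlong_congr (h : ∀ᶠ u in 𝓝 t, X u = Z u) :
    A.covDerivAlong γ X t = A.covDerivAlong γ Z t := by
  have : (fun u ↦ coeffs (γ t) (γ u) (X u)) =ᶠ[𝓝 t] (fun u ↦ coeffs (γ t) (γ u) (Z u)) := by
    filter_upwards [h] with u hu
    rw [hu]
  rw [covDerivAlong_eq, covDerivAlong_eq, this.deriv_eq, h.self_of_nhds]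

lemma covDerivAlong_add (hX : SmoothAlongAt γ X t) (hZ : SmoothAlongAt γ Z t) :
    A.covDerivAlong γ (fun u ↦ X u + Z u) t = A.covDerivAlong γ X t + A.covDerivAlong γ Z t := by
  simp only [covDerivAlong_eq, map_add]
  rw [deriv_fun_add hX.differentiableAt_coeffs hZ.differentiableAt_coeffs, constField_add,
    D_constField_add A (mem_trivSet_self _)]
  simp only [Pi.add_apply, add_apply]
  abel

lemma covDerivAlong_smul {f : ℝ → ℝ} (hf : DifferentiableAt ℝ f t) (hX : SmoothAlongAt γ X t) :
    A.covDerivAlong γ (fun u ↦ f u • X u) t = deriv f t • X t + f t • A.covDerivAlong γ X t := by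
  simp only [covDerivAlong_eq, map_smul]
  rw [deriv_fun_smul hf hX.differentiableAt_coeffs, constField_add, constField_smul, constField_smul,
    D_constField_smul A (mem_trivSet_self _)]
  simp only [Pi.add_apply, Pi.smul_apply, smul_apply]
  rw [constField_coeffs (mem_trivSet_self _), smul_add]
  abel

/-- Together with additivity and the Leibniz rule this determines `D_t` on combinations `∑ fᵢ Yᵢ ∘
γ`. Later arguments can therefore avoid the defining formula, whose trivialization changes with `t`.
-/
lemma covDerivAlong_field {Y : ∀ q : M, TangentSpace (𝓡 2) q}
    (hγ : ContMDiffAt 𝓘(ℝ, ℝ) (𝓡 2) ∞ γ t) (hY : SmoothFieldAt Y (γ t)) :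
    A.covDerivAlong γ (fun u ↦ Y (γ u)) t = A.D Y (γ t) (velocity γ t) := by
  rw [D_eq_constField A (mem_trivSet_self _) hY, covDerivAlong_eq]
  congr 2
  have h1 := (smoothFieldAt_iff (mem_trivSet_self _)).1 hY
  have := mfderiv_comp (I := 𝓘(ℝ, ℝ)) (I' := 𝓡 2) (I'' := 𝓘(ℝ, Plane)) t
    (h1.mdifferentiableAt (by simp)) (hγ.mdifferentiableAt (by simp))
  rw [← fderiv_apply_one_eq_deriv, ← mfderiv_eq_fderiv]
  change mfderiv 𝓘(ℝ, ℝ) 𝓘(ℝ, Plane) ((fun q ↦ coeffs (γ t) q (Y q)) ∘ γ) t (1 : ℝ) = _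
  rw [this]
  rfl

end Along

end EquiAffineStructure

/-! ### Smoothness of `D_t` and the product rule for the area form -/

namespace EquiAffineStructure

variable {M : Type*} [TopologicalSpace M] [ChartedSpace Plane M] [IsManifold (𝓡 2) ∞ M]

attribute [local instance] contMDiffVectorBundle_tangent

/-- Smoothness of the connection is used for vector fields smooth on all of `M`, so coordinate
fields are cut off by a bump function supported in the trivialization domain. -/
lemma exists_smooth_field_eq_constField [T2Space M] (x₀ : M) {x : M} (hx : x ∈ trivSet x₀)
    (c : Plane) : ∃ Y : ∀ q : M, TangentSpace (𝓡 2) q,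
      (∀ q, SmoothFieldAt Y q) ∧ ∀ᶠ q in 𝓝 x, Y q = constField x₀ c q := by
  obtain ⟨ψ, -, hψ⟩ := (SmoothBumpFunction.nhds_basis_tsupport (I := 𝓡 2) x).mem_iff.1
    ((isOpen_trivSet x₀).mem_nhds hx)
  refine ⟨(ψ : M → ℝ) • constField x₀ c, ?_, ?_⟩
  · exact ContMDiffOn.smul_section_of_tsupport (V := (TangentSpace (𝓡 2) : M → Type _))
      ψ.contMDiff.contMDiffOn (isOpen_trivSet x₀) hψ
      (fun q hq ↦ (smoothFieldAt_constField hq c).contMDiffWithinAt)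
  · filter_upwards [ψ.eventuallyEq_one] with q hq
    simp [hq]

/-- A frame of globally smooth vector fields near a point. -/
lemma exists_smooth_frame [T2Space M] (x₀ : M) : ∃ Y : Fin 2 → ∀ q : M, TangentSpace (𝓡 2) q,
    (∀ i q, SmoothFieldAt (Y i) q) ∧ ∀ᶠ q in 𝓝 x₀, ∀ v : TangentSpace (𝓡 2) q,
      v = coeffs x₀ q v 0 • Y 0 q + coeffs x₀ q v 1 • Y 1 q := by
  choose Y hY hY' using fun i : Fin 2 ↦ exists_smooth_field_eq_constField x₀ (mem_trivSet_self x₀)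
    (EuclideanSpace.single i (1 : ℝ))
  refine ⟨Y, hY, ?_⟩
  filter_upwards [hY' 0, hY' 1, (isOpen_trivSet x₀).mem_nhds (mem_trivSet_self x₀)] with q h0 h1 hq v
  conv_lhs => rw [← constField_coeffs hq v, plane_eq_sum (coeffs x₀ q v)]
  simp only [constField_add, constField_smul, h0, h1]
  rfl

variable (A : EquiAffineStructure M)

lemma contMDiff_D {Y : ∀ q : M, TangentSpace (𝓡 2) q} (hY : ∀ q, SmoothFieldAt Y q) :
    ContMDiff (𝓡 2) ((𝓡 2).prod 𝓘(ℝ, Plane →L[ℝ] Plane)) ∞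
      (fun q ↦ (⟨q, A.D Y q⟩ : TotalSpace (Plane →L[ℝ] Plane)
        fun q : M ↦ TangentSpace (𝓡 2) q →L[ℝ] TangentSpace (𝓡 2) q)) :=
  contMDiffOn_univ.1 (A.smooth_D.contMDiff.contMDiff fun q _ ↦ (hY q).contMDiffWithinAt)

section Along

variable {γ : ℝ → M} {X Z : ∀ t, TangentSpace (𝓡 2) (γ t)} {t : ℝ}

lemma smoothAlongAt_D {Y : ∀ q : M, TangentSpace (𝓡 2) q} (hY : ∀ q, SmoothFieldAt Y q)
    (hX : SmoothAlongAt γ X t) : SmoothAlongAt γ (fun u ↦ A.D Y (γ u) (X u)) t :=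
  ContMDiffAt.clm_bundle_apply
    (((contMDiff_D A hY) (γ t)).comp t hX.curve : ContMDiffAt _ _ _
      (fun u ↦ (⟨γ u, A.D Y (γ u)⟩ : TotalSpace (Plane →L[ℝ] Plane)
        fun q : M ↦ TangentSpace (𝓡 2) q →L[ℝ] TangentSpace (𝓡 2) q)) t) hX

/-- A vector field along a curve is, locally, a combination of globally smooth vector fields. -/
lemma SmoothAlongAt.exists_eq_sum [T2Space M] (hX : ∀ᶠ u in 𝓝 t, SmoothAlongAt γ X u) :
    ∃ (Y : Fin 2 → ∀ q : M, TangentSpace (𝓡 2) q) (f : Fin 2 → ℝ → ℝ),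
      (∀ i q, SmoothFieldAt (Y i) q) ∧ (∀ᶠ u in 𝓝 t, ∀ i, ContDiffAt ℝ ∞ (f i) u) ∧
      ∀ᶠ u in 𝓝 t, X u = f 0 u • Y 0 (γ u) + f 1 u • Y 1 (γ u) := by
  obtain ⟨Y, hY, hYs⟩ := exists_smooth_frame (γ t)
  have hc := hX.self_of_nhds.curve.continuousAt
  refine ⟨Y, fun i u ↦ coeffs (γ t) (γ u) (X u) i, hY, ?_, ?_⟩
  · filter_upwards [hX, hc.preimage_mem_nhds
      ((isOpen_trivSet (γ t)).mem_nhds (mem_trivSet_self _))] with u hu hu' i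
    exact (EuclideanSpace.proj (𝕜 := ℝ) i).contDiff.contDiffAt.comp u
      ((smoothAlongAt_iff hu').1 hu).2
  · filter_upwards [hc.eventually hYs] with u hu using hu _

/-- Write `X = ∑ fᵢ Yᵢ ∘ γ` near `t` with global fields `Yᵢ`. Then `D_t X = ∑ (fᵢ' Yᵢ + fᵢ D_{γ'}
Yᵢ)` near `t`, and each term is visibly smooth. -/
lemma SmoothAlongAt.covDerivAlong [T2Space M] (hX : ∀ᶠ u in 𝓝 t, SmoothAlongAt γ X u) :
    SmoothAlongAt γ (A.covDerivAlong γ X) t := by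
  obtain ⟨Y, f, hY, hf, hXe⟩ := SmoothAlongAt.exists_eq_sum hX
  have hγ : ∀ᶠ u in 𝓝 t, ContMDiffAt 𝓘(ℝ, ℝ) (𝓡 2) ∞ γ u := hX.mono fun u h ↦ h.curve
  have hv := smoothAlongAt_velocity hγ
  have key : ∀ i, SmoothAlongAt γ (fun u ↦ deriv (f i) u • Y i (γ u)
      + f i u • A.D (Y i) (γ u) (velocity γ u)) t := fun i ↦
    ((SmoothFieldAt.along hγ.self_of_nhds (hY i _)).smul
        (contDiffAt_infty_deriv (hf.self_of_nhds i))).add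
      ((smoothAlongAt_D A (hY i) hv).smul (hf.self_of_nhds i))
  refine ((key 0).add (key 1)).congr ?_
  filter_upwards [hγ, hf, hXe.eventually_nhds] with u hγu hfu hXu
  have hs : ∀ i, SmoothAlongAt γ (fun u ↦ Y i (γ u)) u := fun i ↦ SmoothFieldAt.along hγu (hY i _)
  rw [covDerivAlong_congr A hXu, covDerivAlong_add A ((hs 0).smul (hfu 0)) ((hs 1).smul (hfu 1)),
    covDerivAlong_smul A ((hfu 0).differentiableAt (by simp)) (hs 0),
    covDerivAlong_smul A ((hfu 1).differentiableAt (by simp)) (hs 1),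
    covDerivAlong_field A hγu (hY 0 _), covDerivAlong_field A hγu (hY 1 _)]

lemma contDiffAt_area (hX : SmoothAlongAt γ X t) (hZ : SmoothAlongAt γ Z t) :
    ContDiffAt ℝ ∞ (fun u ↦ A.Ω (γ u) (X u) (Z u)) t := by
  have : ContMDiffAt 𝓘(ℝ, ℝ) ((𝓡 2).prod 𝓘(ℝ)) ∞
      (fun m ↦ TotalSpace.mk' ℝ (E := Bundle.Trivial M ℝ) (γ m) (A.Ω (γ m) (X m) (Z m))) t := by
    apply ContMDiffAt.clm_bundle_apply₂ (F₁ := Plane) (F₂ := Plane)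
    · exact ContMDiffAt.comp t A.smooth_Ω.contMDiffAt hX.curve
    · exact hX
    · exact hZ
  simp only [contMDiffAt_totalSpace] at this
  exact contMDiffAt_iff_contDiffAt.1 this.2

lemma contMDiffAt_area_field {Y W : ∀ q : M, TangentSpace (𝓡 2) q} {x : M}
    (hY : SmoothFieldAt Y x) (hW : SmoothFieldAt W x) :
    ContMDiffAt (𝓡 2) 𝓘(ℝ, ℝ) ∞ (fun q ↦ A.Ω q (Y q) (W q)) x := by
  have : ContMDiffAt (𝓡 2) ((𝓡 2).prod 𝓘(ℝ)) ∞
      (fun m ↦ TotalSpace.mk' ℝ (E := Bundle.Trivial M ℝ) m (A.Ω m (Y m) (W m))) x := by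
    apply ContMDiffAt.clm_bundle_apply₂ (F₁ := Plane) (F₂ := Plane)
    · exact A.smooth_Ω.contMDiffAt
    · exact hY
    · exact hW
  simp only [contMDiffAt_totalSpace] at this
  exact this.2

/-- This is `parallel` in the direction `γ'`, combined with the chain rule. -/
lemma hasDerivAt_area_field {Y W : ∀ q : M, TangentSpace (𝓡 2) q}
    (hγ : ContMDiffAt 𝓘(ℝ, ℝ) (𝓡 2) ∞ γ t) (hY : SmoothFieldAt Y (γ t))
    (hW : SmoothFieldAt W (γ t)) :
    HasDerivAt (fun u ↦ A.Ω (γ u) (Y (γ u)) (W (γ u)))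
      (A.Ω (γ t) (A.D Y (γ t) (velocity γ t)) (W (γ t))
        + A.Ω (γ t) (Y (γ t)) (A.D W (γ t) (velocity γ t))) t := by
  have hd := (contMDiffAt_area_field A hY hW).mdifferentiableAt (by simp)
  have hdiff : DifferentiableAt ℝ (fun u ↦ A.Ω (γ u) (Y (γ u)) (W (γ u))) t :=
    (contDiffAt_area A (SmoothFieldAt.along hγ hY) (SmoothFieldAt.along hγ hW)).differentiableAt
      (by simp)
  refine hdiff.hasDerivAt.congr_deriv (Eq.symm ?_)
  rw [← A.parallel Y W (γ t) (velocity γ t) hY.mdifferentiableAt hW.mdifferentiableAt]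
  have := mfderiv_comp (I := 𝓘(ℝ, ℝ)) (I' := 𝓡 2) (I'' := 𝓘(ℝ, ℝ)) t hd
    (hγ.mdifferentiableAt (by simp))
  rw [← fderiv_apply_one_eq_deriv, ← mfderiv_eq_fderiv]
  change _ = mfderiv 𝓘(ℝ, ℝ) 𝓘(ℝ, ℝ) ((fun q ↦ A.Ω q (Y q) (W q)) ∘ γ) t (1 : ℝ)
  rw [this]
  rfl

/-- `[X, Z]' = [D_t X, Z] + [X, D_t Z]`. -/
lemma hasDerivAt_area [T2Space M] (hX : ∀ᶠ u in 𝓝 t, SmoothAlongAt γ X u)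
    (hZ : ∀ᶠ u in 𝓝 t, SmoothAlongAt γ Z u) :
    HasDerivAt (fun u ↦ A.Ω (γ u) (X u) (Z u))
      (A.Ω (γ t) (A.covDerivAlong γ X t) (Z t) + A.Ω (γ t) (X t) (A.covDerivAlong γ Z t)) t := by
  obtain ⟨Y, f, hY, hf, hXe⟩ := SmoothAlongAt.exists_eq_sum hX
  obtain ⟨W, g, hW, hg, hZe⟩ := SmoothAlongAt.exists_eq_sum hZ
  have hγ := hX.self_of_nhds.curve
  replace hf := hf.self_of_nhds
  replace hg := hg.self_of_nhds
  have hdf : ∀ i, HasDerivAt (f i) (deriv (f i) t) t := fun i ↦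
    ((hf i).differentiableAt (by simp)).hasDerivAt
  have hdg : ∀ i, HasDerivAt (g i) (deriv (g i) t) t := fun i ↦
    ((hg i).differentiableAt (by simp)).hasDerivAt
  have hs : ∀ i, SmoothAlongAt γ (fun u ↦ Y i (γ u)) t := fun i ↦ SmoothFieldAt.along hγ (hY i _)
  have hs' : ∀ i, SmoothAlongAt γ (fun u ↦ W i (γ u)) t := fun i ↦ SmoothFieldAt.along hγ (hW i _)
  -- `parallel` speaks of fields on `M` only, so the bracket is expanded bilinearly into four terms,
  -- each a scalar function times a bracket of restricted fields.
  have key : ∀ i j, HasDerivAt (fun u ↦ (f i u * g j u) * A.Ω (γ u) (Y i (γ u)) (W j (γ u))) _ t :=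
    fun i j ↦ ((hdf i).mul (hdg j)).mul (hasDerivAt_area_field A hγ (hY i _) (hW j _))
  have hall := ((key 0 0).add (key 0 1)).add ((key 1 0).add (key 1 1))
  refine (hall.congr_of_eventuallyEq ?_).congr_deriv ?_
  · filter_upwards [hXe, hZe] with u h1 h2
    rw [h1, h2]
    simp only [map_add, map_smul, add_apply, smul_apply, smul_eq_mul, Pi.add_apply]
    ring
  · rw [covDerivAlong_congr A hXe, covDerivAlong_congr A hZe,
      covDerivAlong_add A ((hs 0).smul (hf 0)) ((hs 1).smul (hf 1)),
      covDerivAlong_add A ((hs' 0).smul (hg 0)) ((hs' 1).smul (hg 1)),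
      covDerivAlong_smul A (hdf 0).differentiableAt (hs 0),
      covDerivAlong_smul A (hdf 1).differentiableAt (hs 1),
      covDerivAlong_smul A (hdg 0).differentiableAt (hs' 0),
      covDerivAlong_smul A (hdg 1).differentiableAt (hs' 1),
      covDerivAlong_field A hγ (hY 0 _), covDerivAlong_field A hγ (hY 1 _),
      covDerivAlong_field A hγ (hW 0 _), covDerivAlong_field A hγ (hW 1 _),
      hXe.self_of_nhds, hZe.self_of_nhds]
    simp only [map_add, map_smul, add_apply, smul_apply, smul_eq_mul, Pi.mul_apply]
    ring

end Along

end EquiAffineStructure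

/-! ### Brackets of the derivatives of a curve -/

namespace EquiAffineStructure

variable {M : Type*} [TopologicalSpace M] [ChartedSpace Plane M] [IsManifold (𝓡 2) ∞ M]

/-- In dimension two an alternating form is a multiple of the determinant. If it is nonzero, it
vanishes only on dependent pairs. -/
lemma exists_eq_smul_of_alternating {B : Plane →L[ℝ] Plane →L[ℝ] ℝ} (halt : ∀ v, B v v = 0)
    (hB : B ≠ 0) {v w : Plane} (hv : v ≠ 0) (hvw : B v w = 0) : ∃ c : ℝ, w = c • v := by
  set e : Fin 2 → Plane := fun i ↦ EuclideanSpace.single i (1 : ℝ) with he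
  have hflip : B (e 1) (e 0) = -B (e 0) (e 1) := by
    have := halt (e 0 + e 1)
    simp only [map_add, add_apply, halt] at this
    linarith
  have hdet : ∀ x y : Plane, B x y = (x 0 * y 1 - x 1 * y 0) * B (e 0) (e 1) := by
    intro x y
    conv_lhs => rw [plane_eq_sum x, plane_eq_sum y]
    change B (x 0 • e 0 + x 1 • e 1) (y 0 • e 0 + y 1 • e 1) = _
    simp only [map_add, map_smul, add_apply, smul_apply, smul_eq_mul, halt, hflip]
    ring
  have hne : B (e 0) (e 1) ≠ 0 := by
    intro h
    apply hB
    ext x y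
    simp [hdet x y, h]
  have hd : v 0 * w 1 - v 1 * w 0 = 0 := by
    rw [hdet] at hvw
    exact (mul_eq_zero.1 hvw).resolve_right hne
  by_cases h0 : v 0 = 0
  · have h1 : v 1 ≠ 0 := by
      intro h1
      apply hv
      ext i
      fin_cases i <;> simp [h0, h1]
    refine ⟨w 1 / v 1, ?_⟩
    have hw0 : w 0 = 0 := by
      rw [h0] at hd
      have : v 1 * w 0 = 0 := by linarith
      exact (mul_eq_zero.1 this).resolve_left h1
    ext i
    fin_cases i
    · simp [h0, hw0]
    · simp only [Fin.mk_one, PiLp.smul_apply, smul_eq_mul]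
      field_simp
  · refine ⟨w 0 / v 0, ?_⟩
    ext i
    fin_cases i
    · simp only [Fin.zero_eta, PiLp.smul_apply, smul_eq_mul]
      field_simp
    · simp only [Fin.mk_one, PiLp.smul_apply, smul_eq_mul]
      field_simp
      linarith

variable (A : EquiAffineStructure M)

lemma exists_eq_smul_of_area_eq_zero {x : M} {v w : TangentSpace (𝓡 2) x} (hv : v ≠ 0)
    (hvw : A.Ω x v w = 0) : ∃ c : ℝ, w = c • v :=
  exists_eq_smul_of_alternating (B := A.Ω x) (A.alternating x) (A.nonvanishing x) hv hvw

lemma area_swap {x : M} (v w : TangentSpace (𝓡 2) x) : A.Ω x w v = -A.Ω x v w := by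
  have := A.alternating x (v + w)
  simp only [map_add, add_apply, A.alternating] at this
  linarith

variable {γ : ℝ → M} {t : ℝ}

lemma bracket_self (i : ℕ) (t : ℝ) : A.bracket γ i i t = 0 := A.alternating _ _

/-- At an inflection point `γ''` is a multiple of `γ'`. -/
lemma bracket_two_mul_bracket_one (hv : velocity γ t ≠ 0) (h : A.bracket γ 1 2 t = 0) (i j : ℕ) :
    A.bracket γ 2 i t * A.bracket γ 1 j t = A.bracket γ 1 i t * A.bracket γ 2 j t := by
  obtain ⟨c, hc⟩ := exists_eq_smul_of_area_eq_zero A hv h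
  have : ∀ k, A.bracket γ 2 k t = c * A.bracket γ 1 k t := by
    intro k
    rw [bracket, bracket, hc]
    simp only [map_smul, smul_apply, smul_eq_mul]
    rfl
  rw [this, this]
  ring

variable [T2Space M]

lemma smoothAlongAt_curveDeriv (hγ : ∀ᶠ u in 𝓝 t, ContMDiffAt 𝓘(ℝ, ℝ) (𝓡 2) ∞ γ u) (n : ℕ) :
    ∀ᶠ u in 𝓝 t, SmoothAlongAt γ (A.curveDeriv γ (n + 1)) u := by
  induction n with
  | zero => exact hγ.eventually_nhds.mono fun u hu ↦ smoothAlongAt_velocity hu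
  | succ n ih => exact ih.eventually_nhds.mono fun u hu ↦ SmoothAlongAt.covDerivAlong A hu

lemma contDiffAt_bracket (hγ : ∀ᶠ u in 𝓝 t, ContMDiffAt 𝓘(ℝ, ℝ) (𝓡 2) ∞ γ u) (i j : ℕ) :
    ContDiffAt ℝ ∞ (A.bracket γ (i + 1) (j + 1)) t :=
  contDiffAt_area A (smoothAlongAt_curveDeriv A hγ i).self_of_nhds
    (smoothAlongAt_curveDeriv A hγ j).self_of_nhds

lemma hasDerivAt_bracket (hγ : ∀ᶠ u in 𝓝 t, ContMDiffAt 𝓘(ℝ, ℝ) (𝓡 2) ∞ γ u) (i j : ℕ) :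
    HasDerivAt (A.bracket γ (i + 1) (j + 1))
      (A.bracket γ (i + 2) (j + 1) t + A.bracket γ (i + 1) (j + 2) t) t :=
  hasDerivAt_area A (smoothAlongAt_curveDeriv A hγ i) (smoothAlongAt_curveDeriv A hγ j)

lemma hasDerivAt_bracket_one_two (hγ : ∀ᶠ u in 𝓝 t, ContMDiffAt 𝓘(ℝ, ℝ) (𝓡 2) ∞ γ u) :
    HasDerivAt (A.bracket γ 1 2) (A.bracket γ 1 3 t) t :=
  (hasDerivAt_bracket A hγ 0 1).congr_deriv (by rw [bracket_self, zero_add])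

lemma hasDerivAt_bracket_one_three (hγ : ∀ᶠ u in 𝓝 t, ContMDiffAt 𝓘(ℝ, ℝ) (𝓡 2) ∞ γ u) :
    HasDerivAt (A.bracket γ 1 3) (A.bracket γ 1 4 t + A.bracket γ 2 3 t) t :=
  (hasDerivAt_bracket A hγ 0 2).congr_deriv (add_comm _ _)

lemma hasDerivAt_bracket_two_three (hγ : ∀ᶠ u in 𝓝 t, ContMDiffAt 𝓘(ℝ, ℝ) (𝓡 2) ∞ γ u) :
    HasDerivAt (A.bracket γ 2 3) (A.bracket γ 2 4 t) t :=
  (hasDerivAt_bracket A hγ 1 2).congr_deriv (by rw [bracket_self, zero_add])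

end EquiAffineStructure

/-! ### Parameter integrals, Hadamard's lemma and primitives with a cube root weight -/

open MeasureTheory in
lemma hasDerivAt_integral_mul_comp_mul {w u : ℝ → ℝ} (hw : Continuous w) (hu : ContDiff ℝ 1 u)
    (t : ℝ) : HasDerivAt (fun t ↦ ∫ v in (0 : ℝ)..1, w v * u (t * v))
      (∫ v in (0 : ℝ)..1, (w v * v) * deriv u (t * v)) t := by
  have hu' : Continuous (deriv u) := hu.continuous_deriv le_rfl
  have hc : Continuous (fun x : ℝ × ℝ ↦ (w x.2 * x.2) * deriv u (x.1 * x.2)) := by fun_prop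
  -- The dominating function for differentiation under the integral is a constant: the maximum over
  -- a compact set of parameters.
  obtain ⟨C, hC⟩ := ((isCompact_closedBall t 1).prod (isCompact_Icc (a := (0 : ℝ)) (b := 1))
    |>.bddAbove_image (f := fun x : ℝ × ℝ ↦ ‖(w x.2 * x.2) * deriv u (x.1 * x.2)‖)
      hc.norm.continuousOn)
  refine (intervalIntegral.hasDerivAt_integral_of_dominated_loc_of_deriv_le
    (F := fun t v ↦ w v * u (t * v)) (F' := fun t v ↦ (w v * v) * deriv u (t * v))
    (bound := fun _ ↦ C) (s := Metric.closedBall t 1) (Metric.closedBall_mem_nhds t one_pos)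
    ?_ ?_ ?_ ?_ ?_ ?_).2
  · exact Eventually.of_forall fun x ↦
      (by have := hu.continuous; fun_prop : Continuous fun v ↦ w v * u (x * v)).aestronglyMeasurable
  · exact (by have := hu.continuous; fun_prop : Continuous fun v ↦ w v * u (t * v)).intervalIntegrable _ _
  · exact (by fun_prop : Continuous fun v ↦ (w v * v) * deriv u (t * v)).aestronglyMeasurable
  · refine Eventually.of_forall fun v hv x hx ↦ ?_
    rw [uIoc_of_le zero_le_one] at hv
    exact hC ⟨(x, v), ⟨hx, Ioc_subset_Icc_self hv⟩, rfl⟩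
  · exact intervalIntegrable_const
  · refine Eventually.of_forall fun v hv x hx ↦ ?_
    have h1 : HasDerivAt (fun x ↦ x * v) v x := by simpa using (hasDerivAt_id x).mul_const v
    have h2 := ((hu.differentiable one_ne_zero (x * v)).hasDerivAt.comp x h1).const_mul (w v)
    refine h2.congr_deriv (by ring)

/-- Differentiation replaces the weight `w v` by `w v * v` and `u` by `u'`, so the induction runs
over all continuous weights. Mere continuity of `w` admits `|v|^(1/3)`. -/
lemma contDiff_integral_mul_comp_mul {w u : ℝ → ℝ} (hw : Continuous w) (hu : ContDiff ℝ ∞ u) :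
    ContDiff ℝ ∞ (fun t ↦ ∫ v in (0 : ℝ)..1, w v * u (t * v)) := by
  rw [contDiff_infty]
  intro n
  induction n generalizing w u with
  | zero =>
    exact contDiff_zero.2 (continuous_iff_continuousAt.2 fun t ↦
      (hasDerivAt_integral_mul_comp_mul hw (hu.of_le (by simp)) t).continuousAt)
  | succ n ih =>
    have hd := fun t ↦ hasDerivAt_integral_mul_comp_mul hw (hu.of_le (by simp)) t
    push_cast
    rw [contDiff_succ_iff_deriv]
    refine ⟨fun t ↦ (hd t).differentiableAt, by simp, ?_⟩
    rw [funext fun t ↦ (hd t).deriv]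
    exact ih (hw.mul continuous_id) (contDiff_infty_iff_deriv.1 hu).2

/-- Hadamard's lemma in one variable. -/
lemma exists_contDiff_eq_add_mul {u : ℝ → ℝ} (hu : ContDiff ℝ ∞ u) :
    ∃ g : ℝ → ℝ, ContDiff ℝ ∞ g ∧ ∀ t, u t = u 0 + t * g t := by
  refine ⟨fun t ↦ ∫ v in (0 : ℝ)..1, 1 * deriv u (t * v),
    contDiff_integral_mul_comp_mul continuous_const (contDiff_infty_iff_deriv.1 hu).2, fun t ↦ ?_⟩
  have hd : Continuous (deriv u) := hu.continuous_deriv (by simp)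
  have : ∫ v in (0 : ℝ)..1, t * deriv u (t * v) = u (t * 1) - u (t * 0) := by
    refine intervalIntegral.integral_eq_sub_of_hasDerivAt (f := fun v ↦ u (t * v)) (fun v _ ↦ ?_)
      ((by fun_prop : Continuous fun v ↦ t * deriv u (t * v)).intervalIntegrable _ _)
    have h1 : HasDerivAt (fun v ↦ t * v) t v := by simpa using (hasDerivAt_id v).const_mul t
    refine ((hu.differentiable (by simp) (t * v)).hasDerivAt.comp v h1).congr_deriv (by ring)
  rw [intervalIntegral.integral_const_mul] at this
  simp only [one_mul]
  rw [this]
  simp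

/-- A function that is smooth near `0` agrees near `0` with a smooth function on `ℝ`. -/
lemma exists_contDiff_eventuallyEq {u : ℝ → ℝ} {δ : ℝ} (hδ : 0 < δ)
    (hu : ContDiffOn ℝ ∞ u (Ioo (-δ) δ)) : ∃ v : ℝ → ℝ, ContDiff ℝ ∞ v ∧ v =ᶠ[𝓝 0] u := by
  let ψ : ContDiffBump (0 : ℝ) := ⟨δ / 4, δ / 2, by positivity, by linarith⟩
  refine ⟨fun t ↦ ψ t * u t, ?_, ?_⟩
  · rw [contDiff_iff_contDiffAt]
    intro t
    by_cases ht : t ∈ Ioo (-δ) δ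
    · exact ψ.contDiff.contDiffAt.mul (hu.contDiffAt (isOpen_Ioo.mem_nhds ht))
    · have hmem : t ∉ tsupport ψ := by
        rw [ψ.tsupport_eq, Metric.mem_closedBall, dist_zero_right, Real.norm_eq_abs]
        intro h
        have : |t| < δ := lt_of_le_of_lt h (by simp only [ψ]; linarith)
        exact ht ⟨(abs_lt.1 this).1, (abs_lt.1 this).2⟩
      refine (contDiffAt_const (c := (0 : ℝ))).congr_of_eventuallyEq ?_
      filter_upwards [notMem_tsupport_iff_eventuallyEq.1 hmem] with s hs
      simp [hs]
  · filter_upwards [ψ.eventuallyEq_one] with t ht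
    simp [ht]

lemma exists_Ioo_of_eventually {P : ℝ → Prop} (h : ∀ᶠ t in 𝓝 (0 : ℝ), P t) :
    ∃ ε > 0, ∀ t ∈ Ioo (-ε) ε, P t := by
  obtain ⟨ε, hε, h⟩ := Metric.eventually_nhds_iff.1 h
  exact ⟨ε, hε, fun t ht ↦ h (by rw [dist_zero_right, Real.norm_eq_abs, abs_lt]; exact ht)⟩

lemma integral_cbrt : ∫ v in (0 : ℝ)..1, |v| ^ (1 / 3 : ℝ) = 3 / 4 := by
  rw [intervalIntegral.integral_congr (g := fun v ↦ v ^ (1 / 3 : ℝ))]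
  · rw [integral_rpow (by norm_num)]; norm_num
  · intro v hv
    rw [uIcc_of_le zero_le_one] at hv
    simp [abs_of_nonneg hv.1]

/-- The substitution `u = t v`, valid for either sign of `t`, isolates the only non-smooth factor `t
|t|^(1/3)`. -/
lemma integral_cbrt_mul_eq (h : ℝ → ℝ) (t : ℝ) : ∫ u in (0 : ℝ)..t, |u| ^ (1 / 3 : ℝ) * h u
    = t * |t| ^ (1 / 3 : ℝ) * ∫ v in (0 : ℝ)..1, |v| ^ (1 / 3 : ℝ) * h (t * v) := by
  have := intervalIntegral.smul_integral_comp_mul_left (a := 0) (b := 1)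
    (fun u ↦ |u| ^ (1 / 3 : ℝ) * h u) t
  rw [mul_zero, mul_one, smul_eq_mul] at this
  rw [← this, mul_assoc]
  congr 1
  rw [← intervalIntegral.integral_const_mul]
  refine intervalIntegral.integral_congr fun v _ ↦ ?_
  simp only [abs_mul, Real.mul_rpow (abs_nonneg t) (abs_nonneg v)]
  ring

/-- A primitive of `|u| ^ (1/3) * h u` with smooth `h`. -/
lemma exists_integral_cbrt_mul {h : ℝ → ℝ} (hh : ContDiff ℝ ∞ h) :
    ∃ H : ℝ → ℝ, ContDiff ℝ ∞ H ∧ H 0 = 3 / 4 * h 0 ∧ deriv H 0 = 3 / 7 * deriv h 0 ∧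
      deriv (deriv H) 0 = 3 / 10 * deriv (deriv h) 0 ∧
      ∀ t, ∫ u in (0 : ℝ)..t, |u| ^ (1 / 3 : ℝ) * h u = t * |t| ^ (1 / 3 : ℝ) * H t := by
  have hw : Continuous (fun v : ℝ ↦ |v| ^ (1 / 3 : ℝ)) :=
    (Real.continuous_rpow_const (by norm_num)).comp continuous_abs
  have hh1 := (contDiff_infty_iff_deriv.1 hh).2
  have e1 : deriv (fun t ↦ ∫ v in (0 : ℝ)..1, |v| ^ (1 / 3 : ℝ) * h (t * v))
      = fun t ↦ ∫ v in (0 : ℝ)..1, (|v| ^ (1 / 3 : ℝ) * v) * deriv h (t * v) :=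
    funext fun t ↦ (hasDerivAt_integral_mul_comp_mul hw (hh.of_le (by simp)) t).deriv
  have e2 : deriv (fun t ↦ ∫ v in (0 : ℝ)..1, (|v| ^ (1 / 3 : ℝ) * v) * deriv h (t * v))
      = fun t ↦ ∫ v in (0 : ℝ)..1, (|v| ^ (1 / 3 : ℝ) * v * v) * deriv (deriv h) (t * v) :=
    funext fun t ↦ (hasDerivAt_integral_mul_comp_mul (hw.mul continuous_id)
      (hh1.of_le (by simp)) t).deriv
  -- The `k`-th derivative of `H` at `0` is that of `h` times the moment `∫ v^(k + 1/3) = 3 / (3k +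
  -- 4)` over `[0, 1]`.
  have i1 : ∫ v in (0 : ℝ)..1, |v| ^ (1 / 3 : ℝ) * v = 3 / 7 := by
    rw [intervalIntegral.integral_congr (g := fun v ↦ v ^ (4 / 3 : ℝ))]
    · rw [integral_rpow (by norm_num)]; norm_num
    · intro v hv
      rw [uIcc_of_le zero_le_one] at hv
      simp only [abs_of_nonneg hv.1]
      rw [← Real.rpow_add_one' hv.1 (by norm_num)]
      norm_num
  have i2 : ∫ v in (0 : ℝ)..1, |v| ^ (1 / 3 : ℝ) * v * v = 3 / 10 := by
    rw [intervalIntegral.integral_congr (g := fun v ↦ v ^ (7 / 3 : ℝ))]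
    · rw [integral_rpow (by norm_num)]; norm_num
    · intro v hv
      rw [uIcc_of_le zero_le_one] at hv
      simp only [abs_of_nonneg hv.1]
      rw [← Real.rpow_add_one' hv.1 (by norm_num), ← Real.rpow_add_one' hv.1 (by norm_num)]
      norm_num
  refine ⟨fun t ↦ ∫ v in (0 : ℝ)..1, |v| ^ (1 / 3 : ℝ) * h (t * v),
    contDiff_integral_mul_comp_mul hw hh, ?_, ?_, ?_, integral_cbrt_mul_eq h⟩
  · simp only [zero_mul, intervalIntegral.integral_mul_const, integral_cbrt]
  · rw [e1]; simp only [zero_mul, intervalIntegral.integral_mul_const, i1]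
  · rw [e1, e2]; simp only [zero_mul, intervalIntegral.integral_mul_const, i2]

/-! ### Arithmetic of two-jets at the origin -/

/-- `u` has the second order Taylor coefficients `a`, `b`, `c / 2` at `0`. -/
def HasTwoJet (u : ℝ → ℝ) (a b c : ℝ) : Prop :=
  u 0 = a ∧ ∃ u' : ℝ → ℝ, (∀ᶠ t in 𝓝 0, HasDerivAt u (u' t) t) ∧ u' 0 = b ∧ HasDerivAt u' c 0

namespace HasTwoJet

variable {u v : ℝ → ℝ} {a b c a' b' c' : ℝ}

lemma of_contDiff (hu : ContDiff ℝ ∞ u) : HasTwoJet u (u 0) (deriv u 0) (deriv (deriv u) 0) :=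
  ⟨rfl, deriv u, Eventually.of_forall fun t ↦ (hu.differentiable (by simp) t).hasDerivAt, rfl,
    ((contDiff_infty_iff_deriv.1 hu).2.differentiable (by simp) 0).hasDerivAt⟩

lemma const (r : ℝ) : HasTwoJet (fun _ ↦ r) r 0 0 :=
  ⟨rfl, fun _ ↦ 0, Eventually.of_forall fun t ↦ hasDerivAt_const t r, rfl, hasDerivAt_const _ _⟩

lemma id : HasTwoJet (fun t ↦ t) 0 1 0 :=
  ⟨rfl, fun _ ↦ 1, Eventually.of_forall hasDerivAt_id, rfl, hasDerivAt_const _ _⟩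

lemma add (hu : HasTwoJet u a b c) (hv : HasTwoJet v a' b' c') :
    HasTwoJet (fun t ↦ u t + v t) (a + a') (b + b') (c + c') := by
  obtain ⟨h0, u', h1, h2, h3⟩ := hu
  obtain ⟨k0, v', k1, k2, k3⟩ := hv
  refine ⟨by simp only [h0, k0], fun t ↦ u' t + v' t, ?_, by simp only [h2, k2], h3.add k3⟩
  filter_upwards [h1, k1] with t ht kt using ht.add kt

lemma mul (hu : HasTwoJet u a b c) (hv : HasTwoJet v a' b' c') :
    HasTwoJet (fun t ↦ u t * v t) (a * a') (b * a' + a * b') (c * a' + 2 * b * b' + a * c') := by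
  obtain ⟨h0, u', h1, h2, h3⟩ := hu
  obtain ⟨k0, v', k1, k2, k3⟩ := hv
  refine ⟨by simp only [h0, k0], fun t ↦ u' t * v t + u t * v' t, ?_, by simp only [h0, h2, k0, k2], ?_⟩
  · filter_upwards [h1, k1] with t ht kt using ht.mul kt
  · refine ((h3.mul k1.self_of_nhds).add (h1.self_of_nhds.mul k3)).congr_deriv ?_
    rw [h0, h2, k0, k2]
    ring

lemma congr (hu : HasTwoJet u a b c) (h : v =ᶠ[𝓝 0] u) : HasTwoJet v a b c := by
  obtain ⟨h0, u', h1, h2, h3⟩ := hu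
  refine ⟨h.self_of_nhds.trans h0, u', ?_, h2, h3⟩
  filter_upwards [h1, h.eventually_nhds] with t ht ht' using ht.congr_of_eventuallyEq ht'

lemma deriv_eq (hu : HasTwoJet u a b c) : deriv u 0 = b := by
  obtain ⟨-, u', h1, h2, -⟩ := hu
  rw [h1.self_of_nhds.deriv, h2]

lemma deriv_deriv_eq (hu : HasTwoJet u a b c) : deriv (deriv u) 0 = c := by
  obtain ⟨-, u', h1, -, h3⟩ := hu
  have : deriv u =ᶠ[𝓝 0] u' := h1.mono fun t ht ↦ ht.deriv
  rw [this.deriv_eq, h3.deriv]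

lemma unique (hu : HasTwoJet u a b c) (hu' : HasTwoJet u a' b' c') : a = a' ∧ b = b' ∧ c = c' :=
  ⟨hu.1.symm.trans hu'.1, hu.deriv_eq.symm.trans hu'.deriv_eq,
    hu.deriv_deriv_eq.symm.trans hu'.deriv_deriv_eq⟩

lemma pow_three (hu : HasTwoJet u a b c) :
    HasTwoJet (fun t ↦ u t ^ 3) (a ^ 3) (3 * a ^ 2 * b) (3 * a ^ 2 * c + 6 * a * b ^ 2) := by
  convert ((hu.mul hu).mul hu) using 1
  · ext t; ring
  all_goals ring

lemma pow_two (hu : HasTwoJet u a b c) :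
    HasTwoJet (fun t ↦ u t ^ 2) (a ^ 2) (2 * a * b) (2 * a * c + 2 * b ^ 2) := by
  convert (hu.mul hu) using 1
  · ext t; ring
  all_goals ring

lemma pow_four (hu : HasTwoJet u a b c) :
    HasTwoJet (fun t ↦ u t ^ 4) (a ^ 4) (4 * a ^ 3 * b) (4 * a ^ 3 * c + 12 * a ^ 2 * b ^ 2) := by
  convert hu.pow_two.pow_two using 1
  · ext t; ring
  all_goals ring

lemma pow_eight (hu : HasTwoJet u a b c) :
    HasTwoJet (fun t ↦ u t ^ 8) (a ^ 8) (8 * a ^ 7 * b) (8 * a ^ 7 * c + 56 * a ^ 6 * b ^ 2) := by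
  convert hu.pow_two.pow_four using 1
  · ext t; ring
  all_goals ring

end HasTwoJet


/-! ### The normalized curvature near a simple zero of `p` -/

/-- Second order expansion of the normalized curvature, in terms of the expansion of
`h = |p / t| ^ (1/3)`. -/
lemma normalizedCurvature_expansion {σ h0 h1 h2 q0 q1 f0 f1 f2 N0 N1 N2 g0 g1 g2 : ℝ}
    (hσ : σ ^ 2 = 1) (hh : h0 ≠ 0)
    (eg0 : g0 = σ * h0 ^ 3) (eg1 : g1 = σ * (3 * h0 ^ 2 * h1))
    (eg2 : g2 = σ * (3 * h0 ^ 2 * h2 + 6 * h0 * h1 ^ 2))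
    (hc : g0 * q1 = (2 * g1 - q0) * q0)
    (eN0 : N0 = -5 * g0 ^ 2) (eN1 : N1 = -14 * g0 * g1 + 9 * g0 * q0)
    (eN2 : N2 = -28 * g1 ^ 2 - 12 * g0 * g2 + 18 * (g1 * q0 + g0 * q1))
    (ef0 : 9 * f0 * h0 ^ 8 = (3 / 4 * h0) ^ 2 * N0)
    (ef1 : 9 * (f1 * h0 ^ 8 + f0 * (8 * h0 ^ 7 * h1))
      = 2 * (3 / 4 * h0) * (3 / 7 * h1) * N0 + (3 / 4 * h0) ^ 2 * N1)
    (ef2 : 9 * (f2 * h0 ^ 8 + 2 * f1 * (8 * h0 ^ 7 * h1)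
        + f0 * (8 * h0 ^ 7 * h2 + 56 * h0 ^ 6 * h1 ^ 2))
      = (2 * (3 / 4 * h0) * (3 / 10 * h2) + 2 * (3 / 7 * h1) ^ 2) * N0
        + 2 * (2 * (3 / 4 * h0) * (3 / 7 * h1)) * N1 + (3 / 4 * h0) ^ 2 * N2) :
    f0 = -(5 / 16) ∧ f1 = -(9 / 112) * σ * (2 * g1 - 7 * q0) / h0 ^ 3 ∧
      -(9 / 7) * (2 * g1 / g0) * f1 + 32 * f1 ^ 2 + 9 * f2 = 0 := by
  have e0 : f0 = -(5 / 16) := by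
    have h8 : 9 * h0 ^ 8 ≠ 0 := by positivity
    apply mul_left_cancel₀ h8
    rw [eN0, eg0] at ef0
    linear_combination ef0 - 45 / 16 * h0 ^ 8 * hσ
  subst eg0 eg1 eg2
  have e1 : f1 = -(9 / 112) * σ * (2 * (σ * (3 * h0 ^ 2 * h1)) - 7 * q0) / h0 ^ 3 := by
    have h8 : 9 * h0 ^ 8 ≠ 0 := by positivity
    rw [eq_div_iff (by positivity)]
    apply mul_left_cancel₀ h8
    rw [eN0, eN1, e0] at ef1
    rcases sq_eq_one_iff.1 hσ with rfl | rfl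
    · linear_combination h0 ^ 3 * ef1
    · linear_combination h0 ^ 3 * ef1
  -- The inflection identity `p' q' = (p'' - q) q`, solved for `q'(0)`.
  have eq1 : q1 = σ * (2 * (σ * (3 * h0 ^ 2 * h1)) - q0) * q0 / h0 ^ 3 := by
    rw [eq_div_iff (by positivity)]
    linear_combination σ * hc - h0 ^ 3 * q1 * hσ
  refine ⟨e0, e1, ?_⟩
  have e2 : f2 = ((2 * (3 / 4 * h0) * (3 / 10 * h2) + 2 * (3 / 7 * h1) ^ 2) * N0
        + 2 * (2 * (3 / 4 * h0) * (3 / 7 * h1)) * N1 + (3 / 4 * h0) ^ 2 * N2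
        - 9 * (2 * f1 * (8 * h0 ^ 7 * h1)
        + f0 * (8 * h0 ^ 7 * h2 + 56 * h0 ^ 6 * h1 ^ 2))) / (9 * h0 ^ 8) := by
    rw [eq_div_iff (by positivity)]
    linear_combination ef2
  -- After substitution only `h0`, `h1`, `h2`, `q0` and the sign remain. The terms in `h2` cancel,
  -- with coefficients proportional to `-9/4 - 81/4 + 45/2 = 0`.
  rw [e2, eN0, eN1, eN2, e1, e0, eq1]
  rcases sq_eq_one_iff.1 hσ with rfl | rfl
  · field_simp
    ring
  · field_simp
    ring


lemma sign_mul_abs_self (t : ℝ) : Real.sign t * |t| = t := by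
  rcases lt_trichotomy t 0 with h | rfl | h
  · rw [Real.sign_of_neg h, abs_of_neg h]; ring
  · simp
  · rw [Real.sign_of_pos h, abs_of_pos h]; ring

lemma four_rpow_three_quarters : (4 : ℝ) ^ (3 / 4 : ℝ) = 2 * √2 := by
  rw [Real.sqrt_eq_rpow, ← Real.rpow_one_add' (by norm_num) (by norm_num),
    show (4 : ℝ) = 2 ^ (2 : ℕ) by norm_num, ← Real.rpow_natCast, ← Real.rpow_mul (by norm_num)]
  norm_num

lemma exists_contDiff_rpow {u : ℝ → ℝ} (hu : ContDiff ℝ ∞ u) (h0 : 0 < u 0) (r : ℝ) :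
    ∃ v : ℝ → ℝ, ContDiff ℝ ∞ v ∧ v =ᶠ[𝓝 0] fun t ↦ u t ^ r := by
  obtain ⟨ε, hε, h⟩ := exists_Ioo_of_eventually ((hu.continuous.tendsto 0).eventually_const_lt h0)
  exact exists_contDiff_eventuallyEq hε
    (hu.contDiffOn.rpow_const_of_ne fun t ht ↦ (h t ht).ne')

/-- A function with a simple zero at `0` is `± t * h ^ 3` with a smooth positive `h`. -/
lemma exists_eq_mul_cube {p : ℝ → ℝ} (hp : ContDiff ℝ ∞ p) (p0 : p 0 = 0) (p1 : deriv p 0 ≠ 0) :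
    ∃ g h : ℝ → ℝ, ContDiff ℝ ∞ g ∧ ContDiff ℝ ∞ h ∧ 0 < h 0 ∧ (p = fun t ↦ t * g t) ∧
      g =ᶠ[𝓝 0] fun t ↦ Real.sign (deriv p 0) * h t ^ 3 := by
  obtain ⟨g, hg, hpg⟩ := exists_contDiff_eq_add_mul hp
  have hg0 : deriv p 0 = g 0 := by
    have h1 := (HasTwoJet.id.mul (.of_contDiff hg)).congr (v := p)
      (Eventually.of_forall fun t ↦ by rw [hpg t, p0, zero_add])
    rw [h1.deriv_eq]; ring
  set σ := Real.sign (deriv p 0) with hσ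
  have hσ2 : σ * σ = 1 := by
    rcases Real.sign_apply_eq_of_ne_zero _ p1 with h | h <;> rw [hσ, h] <;> norm_num
  have hpos : 0 < σ * g 0 := by
    rw [← hg0]
    exact Real.sign_mul_pos_of_ne_zero _ p1
  obtain ⟨h, hh, hhe⟩ := exists_contDiff_rpow (contDiff_const.mul hg) hpos (1 / 3)
  refine ⟨g, h, hg, hh, ?_, funext fun t ↦ by rw [hpg t, p0, zero_add], ?_⟩
  · rw [hhe.self_of_nhds]; positivity
  · have hcont : Continuous fun t ↦ σ * g t := continuous_const.mul hg.continuous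
    filter_upwards [hhe, (hcont.tendsto 0).eventually_const_lt hpos] with t ht htp
    rw [ht, ← Real.rpow_natCast, ← Real.rpow_mul htp.le]
    norm_num
    rw [← mul_assoc σ, hσ2, one_mul]

/-- Affine arclength, the `3/4`-arclength and the normalized curvature near a generic inflection
point, as functions of `p = [γ', γ'']` and `q = [γ'', γ⁽³⁾]`. -/
theorem exists_smooth_normalizedCurvature {p q : ℝ → ℝ} (hp : ContDiff ℝ ∞ p) (hq : ContDiff ℝ ∞ q)
    (p0 : p 0 = 0) (p1 : deriv p 0 ≠ 0)
    (hc : deriv p 0 * deriv q 0 = (deriv (deriv p) 0 - q 0) * q 0) :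
    ∃ T f : ℝ → ℝ, ContDiff ℝ ∞ T ∧ ContDiff ℝ ∞ f ∧
      (∀ᶠ t in 𝓝 0,
        T t = Real.sign t * |∫ u in (0 : ℝ)..t, |p u| ^ (1 / 3 : ℝ)| ^ (3 / 4 : ℝ)) ∧
      (∀ᶠ t in 𝓝 0, t ≠ 0 → p t ≠ 0 ∧
        f t = (∫ u in (0 : ℝ)..t, |p u| ^ (1 / 3 : ℝ)) ^ 2 *
          ((3 * p t * deriv (deriv p) t + 9 * p t * q t - 5 * deriv p t ^ 2)
            / (9 * |p t| ^ (8 / 3 : ℝ)))) ∧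
      T 0 = 0 ∧ 0 < deriv T 0 ∧ 7 * deriv p 0 * deriv (deriv T) 0 = deriv T 0 * deriv (deriv p) 0 ∧
      f 0 = -(5 / 16) ∧
      deriv f 0 = -(3 * (3 : ℝ) ^ (1 / 4 : ℝ) / (28 * √2)) * (Real.sign (deriv p 0) *
        ((deriv (deriv p) 0 - 7 * q 0) / |deriv p 0| ^ (5 / 4 : ℝ))) * deriv T 0 ∧
      -(9 / 7) * (deriv (deriv p) 0 / deriv p 0) * deriv f 0 + 32 * deriv f 0 ^ 2
        + 9 * deriv (deriv f) 0 = 0 := by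
  obtain ⟨g, h, hg, hh, h0, hpg, egh⟩ := exists_eq_mul_cube hp p0 p1
  set σ := Real.sign (deriv p 0) with hσ
  have hph : ∀ᶠ t in 𝓝 0, p t = t * (σ * h t ^ 3) := by
    filter_upwards [egh] with t ht
    rw [hpg, ← ht]
  have hσ2 : σ ^ 2 = 1 := by
    rcases Real.sign_apply_eq_of_ne_zero _ p1 with h | h <;> rw [hσ, h] <;> norm_num
  have hσa : |σ| = 1 := by
    rcases Real.sign_apply_eq_of_ne_zero _ p1 with h | h <;> rw [hσ, h] <;> norm_num
  obtain ⟨H, hH, H0, H1, H2, hint⟩ := exists_integral_cbrt_mul hh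
  have H0pos : 0 < H 0 := by rw [H0]; positivity
  obtain ⟨R, hR, hRH⟩ := exists_contDiff_rpow hH H0pos (3 / 4)
  have hhpos : ∀ᶠ t in 𝓝 0, 0 < h t := (hh.continuous.tendsto 0).eventually_const_lt h0
  have hHpos : ∀ᶠ t in 𝓝 0, 0 < H t := (hH.continuous.tendsto 0).eventually_const_lt H0pos
  have hpabs : ∀ᶠ t in 𝓝 0, |p t| = |t| * h t ^ 3 := by
    filter_upwards [hph, hhpos] with t ht htp
    rw [ht, abs_mul, abs_mul, hσa, one_mul, abs_of_pos (pow_pos htp 3)]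
  have harc : ∀ᶠ t in 𝓝 0,
      ∫ u in (0 : ℝ)..t, |p u| ^ (1 / 3 : ℝ) = t * |t| ^ (1 / 3 : ℝ) * H t := by
    obtain ⟨ε, hε, hP⟩ := exists_Ioo_of_eventually (hpabs.and hhpos)
    filter_upwards [Ioo_mem_nhds (neg_lt_zero.2 hε) hε] with t ht
    rw [← hint]
    refine intervalIntegral.integral_congr fun u hu ↦ ?_
    have hu' : u ∈ Ioo (-ε) ε :=
      (ordConnected_Ioo.uIcc_subset ⟨neg_lt_zero.2 hε, hε⟩ ht) hu
    obtain ⟨h1, h2⟩ := hP u hu'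
    simp only [h1]
    rw [Real.mul_rpow (abs_nonneg u) (by positivity), ← Real.rpow_natCast, ← Real.rpow_mul h2.le]
    norm_num
  have hNs : ContDiff ℝ ∞ fun t ↦ 3 * p t * deriv (deriv p) t + 9 * p t * q t - 5 * deriv p t ^ 2 := by
    have hp1 := (contDiff_infty_iff_deriv.1 hp).2
    have hp2 := (contDiff_infty_iff_deriv.1 hp1).2
    fun_prop
  set N : ℝ → ℝ := fun t ↦ 3 * p t * deriv (deriv p) t + 9 * p t * q t - 5 * deriv p t ^ 2 with hN
  obtain ⟨f, hf, hfe⟩ : ∃ f : ℝ → ℝ, ContDiff ℝ ∞ f ∧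
      f =ᶠ[𝓝 0] fun t ↦ H t ^ 2 * N t / (9 * h t ^ 8) := by
    obtain ⟨ε, hε, hP⟩ := exists_Ioo_of_eventually hhpos
    refine exists_contDiff_eventuallyEq hε ?_
    refine ((hH.pow 2).mul hNs).contDiffOn.div (contDiff_const.mul (hh.pow 8)).contDiffOn
      fun t ht ↦ ?_
    have := hP t ht
    positivity
  have jh := HasTwoJet.of_contDiff hh
  have jH := HasTwoJet.of_contDiff hH
  have jR := HasTwoJet.of_contDiff hR
  have jf := HasTwoJet.of_contDiff hf
  have jp := HasTwoJet.of_contDiff hp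
  have jq := HasTwoJet.of_contDiff hq
  have jT := HasTwoJet.id.mul jR
  rw [H0, H1, H2] at jH
  have hR0 : R 0 = (3 / 4 * h 0) ^ (3 / 4 : ℝ) := hRH.self_of_nhds.trans (by simp only [H0])
  have hR0pos : 0 < R 0 := by rw [hR0]; positivity
  -- expansion of `R`
  have hR1 : 7 * h 0 * deriv R 0 = 3 * R 0 * deriv h 0 := by
    -- Comparing jets of `R⁴ = H³` gives `R'(0)` without differentiating a real power.
    have e : (fun t ↦ R t ^ 4) =ᶠ[𝓝 0] fun t ↦ H t ^ 3 := by
      filter_upwards [hRH, hHpos] with t ht htp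
      rw [ht, ← Real.rpow_natCast, ← Real.rpow_natCast, ← Real.rpow_mul htp.le]
      norm_num
    obtain ⟨e0, e1, -⟩ := (jR.pow_four.congr e.symm).unique jH.pow_three
    have : 4 * R 0 ^ 3 ≠ 0 := by positivity
    apply mul_left_cancel₀ this
    linear_combination 7 * h 0 * e1 - 12 * deriv h 0 * e0
  -- expansion of `p`
  have hg1 := (contDiff_infty_iff_deriv.1 hg).2
  have hdp : deriv p = fun t ↦ g t + t * deriv g t := by
    ext t
    rw [hpg]
    refine ((hasDerivAt_id t).mul (hg.differentiable (by simp) t).hasDerivAt).deriv.trans ?_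
    simp
  have hddp : deriv (deriv p) = fun t ↦ 2 * deriv g t + t * deriv (deriv g) t := by
    ext t
    rw [hdp]
    refine ((hg.differentiable (by simp) t).hasDerivAt.add ((hasDerivAt_id t).mul
      (hg1.differentiable (by simp) t).hasDerivAt)).deriv.trans ?_
    simp
    ring
  have jg := HasTwoJet.of_contDiff hg
  have jg1 := HasTwoJet.of_contDiff hg1
  have jg2 := HasTwoJet.of_contDiff (contDiff_infty_iff_deriv.1 hg1).2
  obtain ⟨eg0, eg1, eg2⟩ := jg.unique ((((HasTwoJet.const σ).mul jh.pow_three)).congr egh)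
  -- `N` is written through `p = t g`, `p' = g + t g'`, `p'' = 2 g' + t g''`. The second order jet
  -- of `p''` enters multiplied by `p(0) = 0`, so no derivative of `g` beyond the second survives.
  have jN : HasTwoJet N _ _ _ := HasTwoJet.congr
    ((((HasTwoJet.const 3).mul (HasTwoJet.id.mul jg)).mul
      (((HasTwoJet.const 2).mul jg1).add (HasTwoJet.id.mul jg2))).add
      (((HasTwoJet.const 9).mul (HasTwoJet.id.mul jg)).mul jq) |>.add
      ((HasTwoJet.const (-5)).mul (jg.add (HasTwoJet.id.mul jg1)).pow_two))
    (Eventually.of_forall fun t ↦ by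
      simp only [hN]
      rw [congrFun hddp t, congrFun hdp t, congrFun hpg t]
      ring)
  -- With the denominator cleared, the jet of `f` is found from product rules alone.
  have efN : (fun t ↦ 9 * (f t * h t ^ 8)) =ᶠ[𝓝 0] fun t ↦ H t ^ 2 * N t := by
    filter_upwards [hfe, hhpos] with t ht htp
    rw [ht]
    field_simp
  obtain ⟨ef0, ef1, ef2⟩ := (((HasTwoJet.const 9).mul (jf.mul jh.pow_eight)).congr efN.symm).unique
    (jH.pow_two.mul jN)
  have hp1 : deriv p 0 = g 0 := by rw [hdp]; simp
  have hp2 : deriv (deriv p) 0 = 2 * deriv g 0 := by rw [hddp]; simp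
  rw [hp1, hp2] at hc
  obtain ⟨c0, c1, c2⟩ := normalizedCurvature_expansion (N0 := -5 * g 0 ^ 2)
    (N1 := -14 * g 0 * deriv g 0 + 9 * g 0 * q 0)
    (N2 := -28 * deriv g 0 ^ 2 - 12 * g 0 * deriv (deriv g) 0
      + 18 * (deriv g 0 * q 0 + g 0 * deriv q 0)) (h1 := deriv h 0) (h2 := deriv (deriv h) 0)
    (f0 := f 0) (f1 := deriv f 0) (f2 := deriv (deriv f) 0)
    hσ2 h0.ne' (by rw [eg0]) (by rw [eg1]; ring) (by rw [eg2]; ring) hc rfl rfl rfl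
    (by linear_combination ef0) (by linear_combination ef1) (by linear_combination ef2)
  refine ⟨fun t ↦ t * R t, f, contDiff_id.mul hR, hf, ?_, ?_, by simp, ?_, ?_, c0, ?_, ?_⟩
  · filter_upwards [harc, hRH, hHpos] with t ht hRt htp
    have e : |t * |t| ^ (1 / 3 : ℝ) * H t| = |t| ^ (4 / 3 : ℝ) * H t := by
      rw [abs_mul, abs_mul, abs_of_pos htp, abs_of_nonneg (by positivity : 0 ≤ |t| ^ (1 / 3 : ℝ)),
        ← Real.rpow_one_add' (abs_nonneg t) (by norm_num)]
      norm_num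
    rw [ht, hRt, e, Real.mul_rpow (by positivity) htp.le, ← Real.rpow_mul (abs_nonneg t),
      ← mul_assoc]
    norm_num
    exact Or.inl (sign_mul_abs_self t).symm
  · filter_upwards [harc, hfe, hpabs, hhpos, hph] with t ht hft hpt htp hpt' hne
    have ht0 : 0 < |t| := abs_pos.2 hne
    refine ⟨abs_pos.1 (by rw [hpt]; positivity), ?_⟩
    change f t = _ * (N t / _)
    have e1 : (|t| * h t ^ 3) ^ (8 / 3 : ℝ) = |t| ^ (8 / 3 : ℝ) * h t ^ 8 := by
      rw [Real.mul_rpow (abs_nonneg t) (by positivity), ← Real.rpow_natCast, ← Real.rpow_natCast,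
        ← Real.rpow_mul htp.le]
      norm_num
    have e2 : (t * |t| ^ (1 / 3 : ℝ)) ^ 2 = |t| ^ (8 / 3 : ℝ) := by
      rw [← sq_abs, abs_mul, abs_of_nonneg (by positivity : 0 ≤ |t| ^ (1 / 3 : ℝ)),
        ← Real.rpow_one_add' (abs_nonneg t) (by norm_num), ← Real.rpow_natCast,
        ← Real.rpow_mul (abs_nonneg t)]
      norm_num
    -- Both `s_A²` and `|p|^(8/3)` carry the factor `|t|^(8/3)`, which cancels for `t ≠ 0`.
    rw [ht, hft, hpt, mul_pow, e1, e2]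
    have : |t| ^ (8 / 3 : ℝ) ≠ 0 := by positivity
    field_simp
  · rw [jT.deriv_eq]; simpa using hR0pos
  · rw [jT.deriv_eq, jT.deriv_deriv_eq, hp1, hp2, eg0, eg1]
    linear_combination 2 * σ * h 0 ^ 2 * hR1
  · rw [jT.deriv_eq, hp1, hp2, c1]
    have e1 : |g 0| = h 0 ^ 3 := by
      rw [eg0, abs_mul, hσa, one_mul, abs_of_pos (by positivity)]
    have e2 : (h 0 ^ 3) ^ (5 / 4 : ℝ) = h 0 ^ 3 * h 0 ^ (3 / 4 : ℝ) := by
      rw [← Real.rpow_natCast, ← Real.rpow_mul h0.le, ← Real.rpow_add h0]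
      norm_num
    -- The source of the limit constant: `τ'(0) = R 0 = (3/4 h 0)^(3/4)`, and `4^(3/4) = 2√2`.
    have e3 : R 0 = 3 ^ (3 / 4 : ℝ) / (2 * √2) * h 0 ^ (3 / 4 : ℝ) := by
      rw [hR0, Real.mul_rpow (by norm_num) h0.le, Real.div_rpow (by norm_num) (by norm_num)]
      rw [four_rpow_three_quarters]
    have e4 : (3 : ℝ) ^ (1 / 4 : ℝ) * 3 ^ (3 / 4 : ℝ) = 3 := by
      rw [← Real.rpow_add (by norm_num)]; norm_num
    have e5 : √2 * √2 = (2 : ℝ) := Real.mul_self_sqrt (by norm_num)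
    rw [e1, e2, e3]
    have h34 : h 0 ^ (3 / 4 : ℝ) ≠ 0 := by positivity
    have hs : √2 ≠ 0 := by positivity
    field_simp
    linear_combination (-504 * σ * (2 * deriv g 0 - 7 * q 0) * h 0 ^ (3 / 4 : ℝ)) * e5
      + (336 * σ * (2 * deriv g 0 - 7 * q 0) * h 0 ^ (3 / 4 : ℝ)) * e4
  · rw [hp1, hp2]
    exact c2


/-! ### Change of the parameter -/

lemma iteratedDeriv_two_eq (f : ℝ → ℝ) : iteratedDeriv 2 f = deriv (deriv f) := by
  rw [iteratedDeriv_succ, iteratedDeriv_one]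

/-- A smooth function with nonzero derivative is a smooth coordinate on a small interval. -/
lemma exists_openPartialHomeomorph_Ioo {T : ℝ → ℝ} (hT : ContDiff ℝ ∞ T) (hT' : deriv T 0 ≠ 0)
    {P : ℝ → Prop} (hP : ∀ᶠ t in 𝓝 0, P t) :
    ∃ ε > 0, (∀ t ∈ Ioo (-ε) ε, P t) ∧ ∃ τ : OpenPartialHomeomorph ℝ ℝ, τ.source = Ioo (-ε) ε ∧
      (τ : ℝ → ℝ) = T ∧ ContDiffOn ℝ ∞ τ.symm τ.target := by
  have hd : ∀ t, HasDerivAt T (deriv T t) t := fun t ↦ (hT.differentiable (by simp) t).hasDerivAt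
  have hf := (hd 0).hasFDerivAt_equiv hT'
  let e := hT.contDiffAt.toOpenPartialHomeomorph T hf (by simp)
  have he : (e : ℝ → ℝ) = T := rfl
  have hmem : ∀ᶠ t in 𝓝 0, t ∈ e.source := e.open_source.mem_nhds
    (hT.contDiffAt.mem_toOpenPartialHomeomorph_source hf (by simp))
  have hne : ∀ᶠ t in 𝓝 0, deriv T t ≠ 0 :=
    ((hT.continuous_deriv (by simp)).tendsto 0).eventually_ne hT'
  obtain ⟨ε, hε, h⟩ := exists_Ioo_of_eventually ((hP.and hmem).and hne)
  refine ⟨ε, hε, fun t ht ↦ (h t ht).1.1, e.restrOpen (Ioo (-ε) ε) isOpen_Ioo, ?_, he, ?_⟩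
  · rw [OpenPartialHomeomorph.restrOpen_source]
    exact inter_eq_right.2 fun t ht ↦ (h t ht).1.2
  · intro y hy
    have hsrc := (e.restrOpen (Ioo (-ε) ε) isOpen_Ioo).map_target hy
    rw [OpenPartialHomeomorph.restrOpen_source] at hsrc
    exact (OpenPartialHomeomorph.contDiffAt_symm_deriv _ (h _ hsrc.2).2 hy (hd _)
      hT.contDiffAt).contDiffWithinAt

/-- The second order chain rule at `0` for `f = F ∘ T`. -/
lemma deriv_eq_of_comp {F T f : ℝ → ℝ} (hT : ContDiff ℝ ∞ T) (hT0 : T 0 = 0)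
    (hF : ∀ᶠ y in 𝓝 0, ContDiffAt ℝ ∞ F y) (h : ∀ᶠ t in 𝓝 0, F (T t) = f t) :
    deriv f 0 = deriv F 0 * deriv T 0 ∧
      deriv (deriv f) 0 = deriv (deriv F) 0 * deriv T 0 ^ 2 + deriv F 0 * deriv (deriv T) 0 := by
  have hd : ∀ t, HasDerivAt T (deriv T t) t := fun t ↦ (hT.differentiable (by simp) t).hasDerivAt
  have hd2 : HasDerivAt (deriv T) (deriv (deriv T) 0) 0 :=
    ((contDiff_infty_iff_deriv.1 hT).2.differentiable (by simp) 0).hasDerivAt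
  have hFT : ∀ᶠ t in 𝓝 0, ContDiffAt ℝ ∞ F (T t) := by
    have := hT.continuous.tendsto 0
    rw [hT0] at this
    exact this.eventually hF
  have h1 : deriv f =ᶠ[𝓝 0] fun t ↦ deriv F (T t) * deriv T t := by
    filter_upwards [h.eventually_nhds, hFT] with t ht hFt
    have := ((hFt.differentiableAt (by simp)).hasDerivAt.comp t (hd t))
    exact (this.congr_of_eventuallyEq (ht.mono fun u hu ↦ hu.symm)).deriv
  have h2 := EquiAffineStructure.contDiffAt_infty_deriv (hFT.self_of_nhds)
  refine ⟨by simpa only [hT0] using h1.self_of_nhds, ?_⟩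
  rw [h1.deriv_eq]
  have h3 := ((h2.differentiableAt (by simp)).hasDerivAt.comp 0 (hd 0)).mul hd2
  have h4 : deriv (fun t ↦ deriv F (T t) * deriv T t) 0 = _ := h3.deriv
  rw [h4]
  simp only [hT0, Function.comp_apply]
  ring

/-! ### Generic inflection points on the surface -/

namespace EquiAffineStructure

variable {M : Type*} [TopologicalSpace M] [ChartedSpace Plane M] [IsManifold (𝓡 2) ∞ M]

theorem normalizedCurvature_of_isGenericInflection [T2Space M] (A : EquiAffineStructure M)
    (γ : ℝ → M) (δ : ℝ) (hγ : A.IsGenericInflection γ δ) :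
      ∃ ε : ℝ, 0 < ε ∧ ε ≤ δ ∧
        (∀ t ∈ Ioo (-ε) ε, t ≠ 0 → A.bracket γ 1 2 t ≠ 0) ∧
        ∃ τ : OpenPartialHomeomorph ℝ ℝ, τ.source = Ioo (-ε) ε ∧
          EqOn τ (A.threeQuarterArclength γ) (Ioo (-ε) ε) ∧
          ContDiffOn ℝ ∞ τ τ.source ∧ ContDiffOn ℝ ∞ τ.symm τ.target ∧
          ∃ f F : ℝ → ℝ, ContDiffOn ℝ ∞ f (Ioo (-ε) ε) ∧ ContDiffOn ℝ ∞ F τ.target ∧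
            (∀ t ∈ Ioo (-ε) ε, t ≠ 0 → f t = A.normalizedCurvature γ t) ∧
            (∀ t ∈ Ioo (-ε) ε, F (τ t) = f t) ∧
            -(9 / 7) * ((A.bracket γ 1 4 0 + A.bracket γ 2 3 0) / A.bracket γ 1 3 0) * deriv f 0
              + 32 * deriv f 0 ^ 2 + 9 * iteratedDeriv 2 f 0 = 0 ∧
            f 0 = -(5 / 16) ∧
            Tendsto (A.normalizedCurvature γ) (𝓝[≠] 0) (𝓝 (-(5 / 16))) ∧
            Tendsto (fun t ↦ (A.normalizedCurvature γ t + 5 / 16) / A.threeQuarterArclength γ t)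
              (𝓝[≠] 0) (𝓝 (-(3 * (3 : ℝ) ^ (1 / 4 : ℝ) / (28 * √2))
                * A.inflectionalCurvature γ 0)) ∧
            32 * deriv F 0 ^ 2 + 9 * iteratedDeriv 2 F 0 = 0 ∧
            ((∀ᶠ t in 𝓝 (0 : ℝ), A.threeQuarterArclength γ t = t) →
              A.bracket γ 1 4 0 + A.bracket γ 2 3 0 = 0 ∧
              32 * deriv f 0 ^ 2 + 9 * iteratedDeriv 2 f 0 = 0) := by
  have hδ := hγ.pos
  have h0δ : (0 : ℝ) ∈ Ioo (-δ) δ := ⟨neg_lt_zero.2 hδ, hδ⟩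
  have hsm : ∀ t ∈ Ioo (-δ) δ, ∀ᶠ u in 𝓝 t, ContMDiffAt 𝓘(ℝ, ℝ) (𝓡 2) ∞ γ u := fun t ht ↦
    (isOpen_Ioo.eventually_mem ht).mono fun u hu ↦
      hγ.smooth.contMDiffAt (isOpen_Ioo.mem_nhds hu)
  have hsm0 : ∀ᶠ t in 𝓝 (0 : ℝ), ∀ᶠ u in 𝓝 t, ContMDiffAt 𝓘(ℝ, ℝ) (𝓡 2) ∞ γ u :=
    (hsm 0 h0δ).eventually_nhds
  -- The brackets are controlled only on `(-δ, δ)`. They are replaced by globally smooth functions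
  -- with the same germs at `0`.
  obtain ⟨p, hp, hpe⟩ := exists_contDiff_eventuallyEq hδ (u := A.bracket γ 1 2)
    fun t ht ↦ (contDiffAt_bracket A (hsm t ht) 0 1).contDiffWithinAt
  obtain ⟨q, hq, hqe⟩ := exists_contDiff_eventuallyEq hδ (u := A.bracket γ 2 3)
    fun t ht ↦ (contDiffAt_bracket A (hsm t ht) 1 2).contDiffWithinAt
  have hp' : deriv p =ᶠ[𝓝 0] A.bracket γ 1 3 := by
    filter_upwards [hpe.eventually_nhds, hsm0] with t ht hst
    rw [EventuallyEq.deriv_eq ht, (hasDerivAt_bracket_one_two A hst).deriv]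
  have hp'' : deriv (deriv p) =ᶠ[𝓝 0] fun t ↦ A.bracket γ 1 4 t + A.bracket γ 2 3 t := by
    filter_upwards [hp'.eventually_nhds, hsm0] with t ht hst
    rw [EventuallyEq.deriv_eq ht, (hasDerivAt_bracket_one_three A hst).deriv]
  have hq' : deriv q 0 = A.bracket γ 2 4 0 := by
    rw [hqe.deriv_eq, (hasDerivAt_bracket_two_three A (hsm 0 h0δ)).deriv]
  have e0 : p 0 = 0 := hpe.self_of_nhds.trans hγ.inflection
  have e1 : deriv p 0 = A.bracket γ 1 3 0 := hp'.self_of_nhds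
  have e2 : deriv (deriv p) 0 = A.bracket γ 1 4 0 + A.bracket γ 2 3 0 := hp''.self_of_nhds
  have eq0 : q 0 = A.bracket γ 2 3 0 := hqe.self_of_nhds
  obtain ⟨T, f, hT, hf, hTe, hfe, hT0, hT1, hT2, hf0, hf1, hf2⟩ :=
    exists_smooth_normalizedCurvature hp hq e0 (by rw [e1]; exact hγ.generic) (by
      rw [e1, e2, eq0, hq']
      -- The constraint on `q'(0)`: `[γ'', γ⁽⁴⁾][γ', γ⁽³⁾] = [γ', γ⁽⁴⁾][γ'', γ⁽³⁾]` at the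
      -- inflection point.
      have := bracket_two_mul_bracket_one A (hγ.regular 0 h0δ) hγ.inflection 4 3
      linear_combination this)
  have harc : ∀ᶠ t in 𝓝 0, ∫ u in (0 : ℝ)..t, |p u| ^ (1 / 3 : ℝ) = A.arclength γ t := by
    obtain ⟨ε, hε, h⟩ := exists_Ioo_of_eventually hpe
    filter_upwards [Ioo_mem_nhds (neg_lt_zero.2 hε) hε] with t ht
    refine intervalIntegral.integral_congr fun u hu ↦ ?_
    simp only [h u ((ordConnected_Ioo.uIcc_subset ⟨neg_lt_zero.2 hε, hε⟩ ht) hu)]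
  have hTτ : ∀ᶠ t in 𝓝 0, T t = A.threeQuarterArclength γ t := by
    filter_upwards [hTe, harc] with t ht hat
    rw [ht, hat, threeQuarterArclength]
  have hfκ : ∀ᶠ t in 𝓝 0, t ≠ 0 → A.bracket γ 1 2 t ≠ 0 ∧ f t = A.normalizedCurvature γ t := by
    filter_upwards [hfe, harc, hpe, hqe, hp', hp''] with t ht hat hpt hqt hpt' hpt'' hne
    obtain ⟨h1, h2⟩ := ht hne
    rw [hpt] at h1
    refine ⟨h1, ?_⟩
    rw [h2, hat, hpt, hqt, hpt', hpt'', normalizedCurvature, curvature]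
    congr 2
    ring
  have hIoo : ∀ᶠ t in 𝓝 (0 : ℝ), t ∈ Ioo (-δ) δ := isOpen_Ioo.mem_nhds h0δ
  obtain ⟨ε, hε, hP, τ, hτs, hτT, hτsymm⟩ := exists_openPartialHomeomorph_Ioo hT hT1.ne'
    ((hTτ.and hfκ).and hIoo)
  -- Membership in `(-δ, δ)` is part of the property holding on `(-ε, ε)`; if `δ < ε`, it would hold
  -- at `δ` itself.
  have hεδ : ε ≤ δ := by
    by_contra! hlt
    exact lt_irrefl δ (hP δ ⟨by linarith, hlt⟩).2.2
  have h0ε : (0 : ℝ) ∈ Ioo (-ε) ε := ⟨neg_lt_zero.2 hε, hε⟩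
  have h0src : (0 : ℝ) ∈ τ.source := hτs ▸ h0ε
  have h0tgt : (0 : ℝ) ∈ τ.target := by
    have := τ.map_source h0src
    rwa [hτT, hT0] at this
  have hF : ContDiffOn ℝ ∞ (f ∘ τ.symm) τ.target := hf.comp_contDiffOn hτsymm
  have hFτ : ∀ t ∈ Ioo (-ε) ε, (f ∘ τ.symm) (τ t) = f t := fun t ht ↦ by
    rw [Function.comp_apply, τ.left_inv (hτs ▸ ht)]
  obtain ⟨c1, c2⟩ := deriv_eq_of_comp (F := f ∘ τ.symm) (f := f) hT hT0
    ((τ.open_target.eventually_mem h0tgt).mono fun y hy ↦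
      hF.contDiffAt (τ.open_target.mem_nhds hy))
    ((isOpen_Ioo.eventually_mem h0ε).mono fun t ht ↦ by
      rw [← hτT]; exact hFτ t ht)
  have hfκ' : ∀ᶠ t in 𝓝[≠] (0 : ℝ), f t = A.normalizedCurvature γ t := by
    filter_upwards [hfκ.filter_mono nhdsWithin_le_nhds, self_mem_nhdsWithin] with t ht hne
    exact (ht hne).2
  rw [e1, e2] at hf2
  refine ⟨ε, hε, hεδ, fun t ht hne ↦ ((hP t ht).1.2 hne).1, τ, hτs, fun t ht ↦ ?_, ?_, hτsymm,
    f, f ∘ τ.symm, hf.contDiffOn, hF, fun t ht hne ↦ ((hP t ht).1.2 hne).2, hFτ, ?_, hf0, ?_, ?_,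
    ?_, ?_⟩
  · rw [hτT]; exact (hP t ht).1.1
  · rw [hτT]; exact hT.contDiffOn
  · rw [iteratedDeriv_two_eq]; exact hf2
  · rw [← hf0]
    exact ((hf.continuous.tendsto 0).mono_left nhdsWithin_le_nhds).congr' hfκ'
  · have s1 := ((hf.differentiable (by simp) 0).hasDerivAt).tendsto_slope_zero
    have s2 := ((hT.differentiable (by simp) 0).hasDerivAt).tendsto_slope_zero
    -- As `T 0 = 0`, the quotient in question is a ratio of difference quotients at `0`, with limit
    -- `f'(0) / T'(0)`.
    have s3 := s1.div s2 hT1.ne'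
    have hlim : deriv f 0 / deriv T 0 = -(3 * (3 : ℝ) ^ (1 / 4 : ℝ) / (28 * √2))
                * A.inflectionalCurvature γ 0 := by
      rw [div_eq_iff hT1.ne', hf1, e1, e2, eq0, inflectionalCurvature]
      ring
    rw [hlim] at s3
    refine s3.congr' ?_
    filter_upwards [hfκ', hTτ.filter_mono nhdsWithin_le_nhds, self_mem_nhdsWithin] with t ht hTt hne
    have hne' : t ≠ 0 := hne
    simp only [Pi.div_apply, zero_add, hf0, hT0, sub_zero, smul_eq_mul]
    rw [mul_div_mul_left _ _ (inv_ne_zero hne'), ht, hTt]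
    ring
  · rw [iteratedDeriv_two_eq]
    have hb := hγ.generic
    rw [e1, e2] at hT2
    rw [c1, c2] at hf2
    have h2 : deriv (deriv T) 0
        = deriv T 0 * ((A.bracket γ 1 4 0 + A.bracket γ 2 3 0) / A.bracket γ 1 3 0) / 7 := by
      field_simp
      linear_combination hT2
    -- With `f' = F' T'` and `f'' = F'' T'² + F' T''`, the term `9 F' T''` cancels the linear term
    -- of the relation, leaving `T'²` times the claim.
    rw [h2] at hf2
    have h3 : deriv T 0 ^ 2 ≠ 0 := by positivity
    apply mul_left_cancel₀ h3
    linear_combination hf2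
  · intro hτt
    have hTid : T =ᶠ[𝓝 0] id := by
      filter_upwards [hTτ, hτt] with t h1 h2
      rw [h1, h2, id]
    have d1 : deriv T =ᶠ[𝓝 0] fun _ ↦ 1 := by
      filter_upwards [hTid.eventually_nhds] with t ht
      rw [EventuallyEq.deriv_eq ht, deriv_id]
    -- If `T` is the identity near `0`, then `T''(0) = 0`, and `7 p' T'' = T' p''` forces `p''(0) =
    -- 0`.
    have hz : A.bracket γ 1 4 0 + A.bracket γ 2 3 0 = 0 := by
      rw [d1.deriv_eq, deriv_const, d1.self_of_nhds, e2] at hT2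
      linarith
    refine ⟨hz, ?_⟩
    rw [iteratedDeriv_two_eq]
    rw [hz, zero_div] at hf2
    linarith

end EquiAffineStructure


/-! ### Ordinary differential equations -/

/-- Local existence of smooth integral curves of a smooth vector field. -/
lemma exists_smooth_integralCurve {E : Type*} [NormedAddCommGroup E] [NormedSpace ℝ E]
    [CompleteSpace E] {V : E → E} {U : Set E} (hU : IsOpen U) (hV : ContDiffOn ℝ ∞ V U) {x₀ : E}
    (hx₀ : x₀ ∈ U) : ∃ α : ℝ → E, α 0 = x₀ ∧ ∃ ε > 0, ∀ t ∈ Ioo (-ε) ε,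
      α t ∈ U ∧ HasDerivAt α (V (α t)) t ∧ ContDiffAt ℝ ∞ α t := by
  obtain ⟨α, hα0, ε, hε, hα⟩ :=
    ((hV.contDiffAt (hU.mem_nhds hx₀)).of_le (by simp : (1 : ℕ∞ω) ≤ ∞)
      ).exists_forall_mem_closedBall_exists_eq_forall_mem_Ioo_hasDerivAt₀ 0
  rw [zero_sub, zero_add] at hα
  have hcont : ContinuousAt α 0 := (hα 0 ⟨neg_lt_zero.2 hε, hε⟩).continuousAt
  have hmem : ∀ᶠ t in 𝓝 0, α t ∈ U := hcont.eventually (by rw [hα0]; exact hU.mem_nhds hx₀)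
  obtain ⟨ε', hε', h⟩ := exists_Ioo_of_eventually
    (hmem.and (isOpen_Ioo.eventually_mem (⟨neg_lt_zero.2 hε, hε⟩ : (0 : ℝ) ∈ Ioo (-ε) ε)))
  -- Bootstrapping: if `α` is `Cⁿ`, then so is `α' = V ∘ α`, hence `α` is `Cⁿ⁺¹`.
  have hsm : ∀ n : ℕ, ContDiffOn ℝ n α (Ioo (-ε') ε') := by
    intro n
    induction n with
    | zero =>
      exact contDiffOn_zero.2 fun t ht ↦ (hα t (h t ht).2).continuousAt.continuousWithinAt
    | succ n ih =>
      push_cast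
      rw [contDiffOn_succ_iff_deriv_of_isOpen isOpen_Ioo]
      refine ⟨fun t ht ↦ (hα t (h t ht).2).differentiableAt.differentiableWithinAt, by simp, ?_⟩
      refine ((hV.of_le (by exact_mod_cast le_top)).comp ih fun t ht ↦ (h t ht).1).congr
        fun t ht ↦ ?_
      exact (hα t (h t ht).2).deriv
  exact ⟨α, hα0, ε', hε', fun t ht ↦ ⟨(h t ht).1, hα t (h t ht).2,
    (contDiffOn_infty.2 hsm).contDiffAt (isOpen_Ioo.mem_nhds ht)⟩⟩

lemma eq_of_hasDerivAt_zero_Ioo {f : ℝ → ℝ} {ε : ℝ}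
    (hf : ∀ t ∈ Ioo (-ε) ε, HasDerivAt f 0 t) {t : ℝ} (ht : t ∈ Ioo (-ε) ε) : f t = f 0 := by
  have hε : 0 < ε := by linarith [ht.1, ht.2]
  exact isOpen_Ioo.is_const_of_deriv_eq_zero isPreconnected_Ioo
    (fun u hu ↦ (hf u hu).differentiableAt.differentiableWithinAt) (fun u hu ↦ (hf u hu).deriv) ht
    ⟨neg_lt_zero.2 hε, hε⟩

/-! ### The connection form in a fixed trivialization -/

namespace EquiAffineStructure

variable {M : Type*} [TopologicalSpace M] [ChartedSpace Plane M] [IsManifold (𝓡 2) ∞ M]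

attribute [local instance] contMDiffVectorBundle_tangent

variable (A : EquiAffineStructure M)

/-- The connection form in the trivialization at `x₀`: the coefficients of `D_w Y`, where `Y` has
constant coefficients `c` and `w` has coefficients `v`. -/
def christoffel (x₀ : M) (c v : Plane) (q : M) : Plane :=
  coeffs x₀ q (A.D (constField x₀ c) q (constField x₀ v q))

/-- Bilinearity reduces joint smoothness in point and vectors to smoothness of the connection form
on basis vectors. -/
lemma christoffel_eq_sum {x₀ q : M} (hq : q ∈ trivSet x₀) (c v : Plane) :
    A.christoffel x₀ c v q = ∑ i : Fin 2, ∑ j : Fin 2, (c i * v j) •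
      A.christoffel x₀ (EuclideanSpace.single i 1) (EuclideanSpace.single j 1) q := by
  have h : ∀ c₀ c₁ v₀ v₁ : ℝ, A.christoffel x₀
      (c₀ • EuclideanSpace.single 0 1 + c₁ • EuclideanSpace.single 1 1)
      (v₀ • EuclideanSpace.single 0 1 + v₁ • EuclideanSpace.single 1 1) q
      = ∑ i : Fin 2, ∑ j : Fin 2, (![c₀, c₁] i * ![v₀, v₁] j) •
        A.christoffel x₀ (EuclideanSpace.single i 1) (EuclideanSpace.single j 1) q := by
    intro c₀ c₁ v₀ v₁
    unfold christoffel
    rw [D_constField_add A hq, D_constField_smul A hq, D_constField_smul A hq, constField_add,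
      constField_smul, constField_smul]
    simp only [Fin.sum_univ_two, Pi.add_apply, Pi.smul_apply, map_add, map_smul, add_apply,
      smul_apply, Matrix.cons_val_zero, Matrix.cons_val_one]
    module
  have h' := h (c 0) (c 1) (v 0) (v 1)
  rw [← plane_eq_sum, ← plane_eq_sum] at h'
  rw [h']
  simp only [Fin.sum_univ_two, Matrix.cons_val_zero, Matrix.cons_val_one]

lemma contMDiffAt_christoffel [T2Space M] {x₀ q : M} (hq : q ∈ trivSet x₀) (c v : Plane) :
    ContMDiffAt (𝓡 2) 𝓘(ℝ, Plane) ∞ (A.christoffel x₀ c v) q := by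
  obtain ⟨Y, hY, hYe⟩ := exists_smooth_field_eq_constField x₀ hq c
  obtain ⟨W, hW, hWe⟩ := exists_smooth_field_eq_constField x₀ hq v
  have h1 : SmoothFieldAt (fun q ↦ A.D Y q (W q)) q :=
    ContMDiffAt.clm_bundle_apply (contMDiff_D A hY q) (hW q)
  refine ((smoothFieldAt_iff hq).1 h1).congr_of_eventuallyEq ?_
  filter_upwards [hYe.eventually_nhds, hWe, (isOpen_trivSet x₀).mem_nhds hq] with r h1 h2 h3
  rw [christoffel, h2, D_congr A (hY r) (smoothFieldAt_constField h3 c) h1]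

lemma smoothAlongAt_constField {γ : ℝ → M} {ξ : ℝ → Plane} {t : ℝ} {x₀ : M}
    (hx : γ t ∈ trivSet x₀) (hγ : ContMDiffAt 𝓘(ℝ, ℝ) (𝓡 2) ∞ γ t) (hξ : ContDiffAt ℝ ∞ ξ t) :
    SmoothAlongAt γ (fun u ↦ constField x₀ (ξ u) (γ u)) t := by
  rw [smoothAlongAt_iff hx]
  refine ⟨hγ, hξ.congr_of_eventuallyEq ?_⟩
  filter_upwards [hγ.continuousAt.preimage_mem_nhds ((isOpen_trivSet x₀).mem_nhds hx)] with u hu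
  exact coeffs_constField hu _

/-- The definition of `D_t` uses the trivialization at the moving point `γ t`. An ODE in one chart
needs the same formula in a fixed trivialization, obtained by expanding in the coordinate frame at
`x₀`. -/
lemma covDerivAlong_constField {γ : ℝ → M} {ξ : ℝ → Plane} {t : ℝ} {x₀ : M}
    (hx : γ t ∈ trivSet x₀) (hγ : ContMDiffAt 𝓘(ℝ, ℝ) (𝓡 2) ∞ γ t) (hξ : ContDiffAt ℝ ∞ ξ t) :
    A.covDerivAlong γ (fun u ↦ constField x₀ (ξ u) (γ u)) t
      = constField x₀ (deriv ξ t) (γ t)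
        + A.D (constField x₀ (ξ t)) (γ t) (velocity γ t) := by
  have hi : ∀ i, ContDiffAt ℝ ∞ (fun u ↦ ξ u i) t := fun i ↦
    (EuclideanSpace.proj (𝕜 := ℝ) i).contDiff.contDiffAt.comp t hξ
  have hdi : ∀ i, deriv (fun u ↦ ξ u i) t = deriv ξ t i := fun i ↦
    ((EuclideanSpace.proj (𝕜 := ℝ) i).hasFDerivAt.comp_hasDerivAt t
      (hξ.differentiableAt (by simp)).hasDerivAt).deriv
  have hE : ∀ i : Fin 2, SmoothFieldAt (constField x₀ (EuclideanSpace.single i (1 : ℝ))) (γ t) :=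
    fun i ↦ smoothFieldAt_constField hx _
  have hs := fun i ↦ SmoothFieldAt.along hγ (hE i)
  have h0 : ∀ u, constField x₀ (ξ u) (γ u)
      = ξ u 0 • constField x₀ (EuclideanSpace.single 0 (1 : ℝ)) (γ u)
        + ξ u 1 • constField x₀ (EuclideanSpace.single 1 (1 : ℝ)) (γ u) := by
    intro u
    conv_lhs => rw [plane_eq_sum (ξ u)]
    rw [constField_add, constField_smul, constField_smul]
    rfl
  rw [covDerivAlong_congr A (Eventually.of_forall h0),
    covDerivAlong_add A ((hs 0).smul (hi 0)) ((hs 1).smul (hi 1)),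
    covDerivAlong_smul A ((hi 0).differentiableAt (by simp)) (hs 0),
    covDerivAlong_smul A ((hi 1).differentiableAt (by simp)) (hs 1),
    covDerivAlong_field A hγ (hE 0), covDerivAlong_field A hγ (hE 1), hdi, hdi]
  conv_rhs => rw [plane_eq_sum (deriv ξ t), plane_eq_sum (ξ t)]
  rw [D_constField_add A hx, D_constField_smul A hx, D_constField_smul A hx, constField_add,
    constField_smul, constField_smul]
  simp only [Pi.add_apply, Pi.smul_apply, add_apply, smul_apply]
  abel

end EquiAffineStructure


/-! ### Moving frames with prescribed structure equations -/

namespace EquiAffineStructure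

variable {M : Type*} [TopologicalSpace M] [ChartedSpace Plane M] [IsManifold (𝓡 2) ∞ M]

variable (A : EquiAffineStructure M)

lemma exists_area_eq_one (x : M) : ∃ v w : TangentSpace (𝓡 2) x, A.Ω x v w = 1 := by
  have h : ∃ v w : TangentSpace (𝓡 2) x, A.Ω x v w ≠ 0 := by
    by_contra! h
    exact A.nonvanishing x (by ext v w; exact h v w)
  obtain ⟨v, w, h⟩ := h
  refine ⟨v, (A.Ω x v w)⁻¹ • w, ?_⟩
  rw [map_smul, smul_eq_mul, inv_mul_cancel₀ h]

/-- The connection form in a chart, as a function of the point and of the two vectors, is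
smooth. -/
lemma contDiffOn_christoffel [T2Space M] (x₀ : M) :
    ContDiffOn ℝ ∞ (fun p : Plane × Plane × Plane ↦
      A.christoffel x₀ p.2.1 p.2.2 ((extChartAt (𝓡 2) x₀).symm p.1))
      ((extChartAt (𝓡 2) x₀).target ×ˢ univ) := by
  have hmaps : ∀ y ∈ (extChartAt (𝓡 2) x₀).target,
      (extChartAt (𝓡 2) x₀).symm y ∈ trivSet x₀ := fun y hy ↦ by
    have := (extChartAt (𝓡 2) x₀).map_target hy
    rwa [extChartAt_source, ← trivSet_eq] at this
  have hbase : ∀ c v : Plane, ContDiffOn ℝ ∞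
      (fun y ↦ A.christoffel x₀ c v ((extChartAt (𝓡 2) x₀).symm y))
      (extChartAt (𝓡 2) x₀).target := fun c v y hy ↦ by
    have h1 := contMDiffAt_christoffel A (hmaps y hy) c v
    have h2 := (contMDiffOn_extChartAt_symm (I := 𝓡 2) (n := ∞) x₀) y hy
    exact (ContMDiffAt.comp_contMDiffWithinAt y h1 h2).contDiffWithinAt
  have hsum : ContDiffOn ℝ ∞ (fun p : Plane × Plane × Plane ↦ ∑ i : Fin 2, ∑ j : Fin 2,
      (p.2.1 i * p.2.2 j) • A.christoffel x₀ (EuclideanSpace.single i 1)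
        (EuclideanSpace.single j 1) ((extChartAt (𝓡 2) x₀).symm p.1))
      ((extChartAt (𝓡 2) x₀).target ×ˢ univ) := by
    refine ContDiffOn.sum fun i _ ↦ ContDiffOn.sum fun j _ ↦ ?_
    refine ContDiffOn.smul (f := fun p : Plane × Plane × Plane ↦ p.2.1 i * p.2.2 j) ?_ ?_
    · have h1 : ContDiff ℝ ∞ (fun p : Plane × Plane × Plane ↦ p.2.1 i) :=
        (EuclideanSpace.proj (𝕜 := ℝ) i).contDiff.comp (contDiff_fst.comp contDiff_snd)
      have h2 : ContDiff ℝ ∞ (fun p : Plane × Plane × Plane ↦ p.2.2 j) :=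
        (EuclideanSpace.proj (𝕜 := ℝ) j).contDiff.comp (contDiff_snd.comp contDiff_snd)
      exact (h1.mul h2).contDiffOn
    · exact (hbase _ _).comp contDiff_fst.contDiffOn fun p hp ↦ hp.1
  exact hsum.congr fun p hp ↦ A.christoffel_eq_sum (hmaps _ hp.1) _ _

/-- The fundamental theorem for frames along curves: a moving frame with prescribed structure
equations `D_t γ' = a γ' + b E`, `D_t E = x γ' - a E` exists. -/
lemma exists_curve_of_structure_equations [T2Space M] [Nonempty M] {a b x : ℝ → ℝ}
    (ha : ContDiff ℝ ∞ a) (hb : ContDiff ℝ ∞ b) (hx : ContDiff ℝ ∞ x) :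
    ∃ (γ : ℝ → M) (E : ∀ t, TangentSpace (𝓡 2) (γ t)), ∃ ε > 0, ∀ t ∈ Ioo (-ε) ε,
      ContMDiffAt 𝓘(ℝ, ℝ) (𝓡 2) ∞ γ t ∧ SmoothAlongAt γ E t ∧
      A.covDerivAlong γ (velocity γ) t = a t • velocity γ t + b t • E t ∧
      A.covDerivAlong γ E t = x t • velocity γ t - a t • E t ∧
      A.Ω (γ t) (velocity γ t) (E t) = 1 := by
  obtain ⟨x₀⟩ := ‹Nonempty M›
  obtain ⟨v, w, hvw⟩ := A.exists_area_eq_one x₀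
  set φ := extChartAt (𝓡 2) x₀ with hφ
  set Γ : Plane × Plane × Plane → Plane :=
    fun p ↦ A.christoffel x₀ p.2.1 p.2.2 (φ.symm p.1) with hΓ
  have hmaps : ∀ y ∈ φ.target, φ.symm y ∈ trivSet x₀ := fun y hy ↦ by
    have := φ.map_target hy
    rwa [extChartAt_source, ← trivSet_eq] at this
  set U : Set (ℝ × Plane × Plane × Plane) := {p | p.2.1 ∈ φ.target} with hU
  -- The state is (time, point, velocity, `E`) in chart coordinates. The clock in the first slot
  -- makes the system autonomous; the connection form is subtracted to turn `D_t` into ordinary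
  -- derivatives.
  set V : ℝ × Plane × Plane × Plane → ℝ × Plane × Plane × Plane := fun p ↦
    (1, p.2.2.1, a p.1 • p.2.2.1 + b p.1 • p.2.2.2 - Γ (p.2.1, p.2.2.1, p.2.2.1),
      x p.1 • p.2.2.1 - a p.1 • p.2.2.2 - Γ (p.2.1, p.2.2.2, p.2.2.1)) with hV
  have hUo : IsOpen U := (isOpen_extChartAt_target x₀).preimage (by fun_prop)
  have hVs : ContDiffOn ℝ ∞ V U := by
    have h1 : ContDiff ℝ ∞ (fun p : ℝ × Plane × Plane × Plane ↦ p.2.1) := by fun_prop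
    have h2 : ContDiff ℝ ∞ (fun p : ℝ × Plane × Plane × Plane ↦ p.2.2.1) := by fun_prop
    have h3 : ContDiff ℝ ∞ (fun p : ℝ × Plane × Plane × Plane ↦ p.2.2.2) := by fun_prop
    have h0 : ContDiff ℝ ∞ (fun p : ℝ × Plane × Plane × Plane ↦ p.1) := by fun_prop
    have hG := A.contDiffOn_christoffel x₀
    refine contDiffOn_const.prodMk (h2.contDiffOn.prodMk (ContDiffOn.prodMk ?_ ?_))
    · exact ((((ha.comp h0).smul h2).add ((hb.comp h0).smul h3)).contDiffOn).sub
        (hG.comp (h1.prodMk (h2.prodMk h2)).contDiffOn fun p hp ↦ ⟨hp, mem_univ _⟩)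
    · exact ((((hx.comp h0).smul h2).sub ((ha.comp h0).smul h3)).contDiffOn).sub
        (hG.comp (h1.prodMk (h3.prodMk h2)).contDiffOn fun p hp ↦ ⟨hp, mem_univ _⟩)
  obtain ⟨α, hα0, ε, hε, hα⟩ := exists_smooth_integralCurve hUo hVs
    (x₀ := (0, φ x₀, coeffs x₀ x₀ v, coeffs x₀ x₀ w)) (mem_extChartAt_target x₀)
  set y : ℝ → Plane := fun t ↦ (α t).2.1 with hy
  set ξ : ℝ → Plane := fun t ↦ (α t).2.2.1 with hξ
  set η : ℝ → Plane := fun t ↦ (α t).2.2.2 with hη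
  set γ : ℝ → M := fun t ↦ φ.symm (y t) with hγ
  set E : ∀ t, TangentSpace (𝓡 2) (γ t) := fun t ↦ constField x₀ (η t) (γ t) with hE
  have hnhds : ∀ t ∈ Ioo (-ε) ε, ∀ᶠ u in 𝓝 t, u ∈ Ioo (-ε) ε :=
    fun t ht ↦ isOpen_Ioo.eventually_mem ht
  have hs : ∀ t ∈ Ioo (-ε) ε, (α t).1 = t := by
    intro t ht
    have h := eq_of_hasDerivAt_zero_Ioo (f := fun t ↦ (α t).1 - t) (ε := ε) (fun u hu ↦ by
      have h := ((ContinuousLinearMap.fst ℝ ℝ (Plane × Plane × Plane)).hasFDerivAt.comp_hasDerivAt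
        u (hα u hu).2.1).sub (hasDerivAt_id u)
      rwa [show ContinuousLinearMap.fst ℝ ℝ (Plane × Plane × Plane) (V (α u)) - 1 = 0 from
        sub_self 1] at h) ht
    simp only [hα0, sub_zero] at h
    linarith
  have hyt : ∀ t ∈ Ioo (-ε) ε, y t ∈ φ.target := fun t ht ↦ (hα t ht).1
  have hγt : ∀ t ∈ Ioo (-ε) ε, γ t ∈ trivSet x₀ := fun t ht ↦ hmaps _ (hyt t ht)
  have hys : ∀ t ∈ Ioo (-ε) ε, ContDiffAt ℝ ∞ y t := fun t ht ↦ (hα t ht).2.2.snd.fst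
  have hξs : ∀ t ∈ Ioo (-ε) ε, ContDiffAt ℝ ∞ ξ t := fun t ht ↦ (hα t ht).2.2.snd.snd.fst
  have hηs : ∀ t ∈ Ioo (-ε) ε, ContDiffAt ℝ ∞ η t := fun t ht ↦ (hα t ht).2.2.snd.snd.snd
  set L := ContinuousLinearMap.snd ℝ ℝ (Plane × Plane × Plane) with hL
  set L' := (ContinuousLinearMap.snd ℝ Plane (Plane × Plane)).comp L with hL'
  have hyd : ∀ t ∈ Ioo (-ε) ε, deriv y t = ξ t := fun t ht ↦
    (((ContinuousLinearMap.fst ℝ Plane (Plane × Plane)).comp L).hasFDerivAt.comp_hasDerivAt t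
      (hα t ht).2.1).deriv
  have hξd : ∀ t ∈ Ioo (-ε) ε, deriv ξ t = a t • ξ t + b t • η t - Γ (y t, ξ t, ξ t) := by
    intro t ht
    have h := (((ContinuousLinearMap.fst ℝ Plane Plane).comp L').hasFDerivAt.comp_hasDerivAt t
      (hα t ht).2.1).deriv
    refine h.trans ?_
    simp only [hV, hL', hL, ContinuousLinearMap.comp_apply, ContinuousLinearMap.coe_fst',
      ContinuousLinearMap.coe_snd', hs t ht, hy, hξ, hη]
  have hηd : ∀ t ∈ Ioo (-ε) ε, deriv η t = x t • ξ t - a t • η t - Γ (y t, η t, ξ t) := by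
    intro t ht
    have h := (((ContinuousLinearMap.snd ℝ Plane Plane).comp L').hasFDerivAt.comp_hasDerivAt t
      (hα t ht).2.1).deriv
    refine h.trans ?_
    simp only [hV, hL', hL, ContinuousLinearMap.comp_apply, ContinuousLinearMap.coe_snd',
      hs t ht, hy, hξ, hη]
  have hγs : ∀ t ∈ Ioo (-ε) ε, ContMDiffAt 𝓘(ℝ, ℝ) (𝓡 2) ∞ γ t := fun t ht ↦
    ((contMDiffOn_extChartAt_symm (I := 𝓡 2) (n := ∞) x₀).contMDiffAt
      ((isOpen_extChartAt_target x₀).mem_nhds (hyt t ht))).comp t (hys t ht).contMDiffAt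
  have hvel : ∀ t ∈ Ioo (-ε) ε, velocity γ t = constField x₀ (ξ t) (γ t) := by
    intro t ht
    rw [← constField_coeffs (hγt t ht) (velocity γ t),
      coeffs_velocity (hγt t ht) ((hγs t ht).mdifferentiableAt (by simp)), ← hyd t ht]
    congr 1
    refine EventuallyEq.deriv_eq ?_
    filter_upwards [hnhds t ht] with u hu
    exact φ.right_inv (hyt u hu)
  have hEs : ∀ t ∈ Ioo (-ε) ε, SmoothAlongAt γ E t := fun t ht ↦
    smoothAlongAt_constField (hγt t ht) (hγs t ht) (hηs t ht)
  have hvs : ∀ t ∈ Ioo (-ε) ε, SmoothAlongAt γ (velocity γ) t := fun t ht ↦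
    smoothAlongAt_velocity ((hnhds t ht).mono hγs)
  have hD : ∀ t ∈ Ioo (-ε) ε, ∀ c : Plane,
      A.D (constField x₀ c) (γ t) (velocity γ t) = constField x₀ (Γ (y t, c, ξ t)) (γ t) := by
    intro t ht c
    rw [hvel t ht]
    exact (constField_coeffs (hγt t ht) _).symm
  have hsum : ∀ (t : ℝ) (c d : Plane) (r s : ℝ),
      constField x₀ (r • c + s • d) (γ t) = r • constField x₀ c (γ t) + s • constField x₀ d (γ t) := by
    intro t c d r s
    rw [constField_add, constField_smul, constField_smul]
    rfl
  have hadd : ∀ (t : ℝ) (c d : Plane),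
      constField x₀ (c - d) (γ t) + constField x₀ d (γ t) = constField x₀ c (γ t) := by
    intro t c d
    rw [← Pi.add_apply, ← constField_add, sub_add_cancel]
  have hDv : ∀ t ∈ Ioo (-ε) ε,
      A.covDerivAlong γ (velocity γ) t = a t • velocity γ t + b t • E t := by
    intro t ht
    rw [covDerivAlong_congr A ((hnhds t ht).mono hvel),
      covDerivAlong_constField A (hγt t ht) (hγs t ht) (hξs t ht), hD t ht, hξd t ht, hadd, hsum,
      hvel t ht]
  have hDE : ∀ t ∈ Ioo (-ε) ε,
      A.covDerivAlong γ E t = x t • velocity γ t - a t • E t := by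
    intro t ht
    rw [covDerivAlong_constField A (hγt t ht) (hγs t ht) (hηs t ht), hD t ht, hηd t ht, hadd,
      sub_eq_add_neg, ← neg_smul, hsum, hvel t ht, neg_smul, ← sub_eq_add_neg]
  refine ⟨γ, E, ε, hε, fun t ht ↦ ⟨hγs t ht, hEs t ht, hDv t ht, hDE t ht, ?_⟩⟩
  have h0 : (0 : ℝ) ∈ Ioo (-ε) ε := ⟨neg_lt_zero.2 hε, hε⟩
  -- The coefficient matrix is trace-free: `[γ', E]' = a [γ', E] - a [γ', E] = 0`.
  have hconst := eq_of_hasDerivAt_zero_Ioo (f := fun t ↦ A.Ω (γ t) (velocity γ t) (E t)) (ε := ε)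
    (fun u hu ↦ by
      have h := hasDerivAt_area A ((hnhds u hu).mono hvs) ((hnhds u hu).mono hEs)
      rw [hDv u hu, hDE u hu] at h
      convert h using 1
      simp only [map_add, map_sub, map_smul, add_apply, smul_apply, A.alternating, smul_eq_mul]
      ring) ht
  rw [hconst, hvel 0 h0]
  have hγ0 : γ 0 = x₀ := by
    rw [hγ]
    simp only [hy, hα0]
    exact extChartAt_to_inv x₀
  -- The base point is made a variable because `γ 0 = x₀` is not definitional and the tangent spaces
  -- depend on it.
  have hgen : ∀ q : M, q = x₀ → A.Ω q (constField x₀ (coeffs x₀ x₀ v) q)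
      (constField x₀ (coeffs x₀ x₀ w) q) = 1 := by
    rintro q rfl
    rw [constField_coeffs (mem_trivSet_self _), constField_coeffs (mem_trivSet_self _), hvw]
  have := hgen (γ 0) hγ0
  simpa only [hE, hξ, hη, hα0] using this

end EquiAffineStructure


/-! ### Realization of a prescribed normalized curvature -/

/-- Hadamard's lemma applied three times gives `f = f(0) + g(0) t + g₁(0) t² + g₂(t) t³`. The
hypothesis on the two-jet says `g₁(0) = -(16/9) g(0)²`, so `c = (16/9) g(0)` matches both middle
coefficients, and `x = -(3/4) g₂` matches the remainder. The right-hand side is the normalized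
curvature of the frame curve with coefficients `c`, `(4/3)³ t`, `x`. -/
lemma exists_contDiff_structure_coefficient {f : ℝ → ℝ} (hf : ContDiff ℝ ∞ f)
    (h0 : f 0 = -(5 / 16)) (h : 32 * deriv f 0 ^ 2 + 9 * deriv (deriv f) 0 = 0) :
    ∃ (c : ℝ) (x : ℝ → ℝ), ContDiff ℝ ∞ x ∧ ∀ t, f t = -(5 / 16) + (3 / 4) ^ 5 * t *
      (64 / 27 * c - 64 / 27 * t * (c ^ 2 + 64 / 27 * t * x t)) := by
  obtain ⟨g, hg, hfg⟩ := exists_contDiff_eq_add_mul hf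
  obtain ⟨g₁, hg₁, hgg₁⟩ := exists_contDiff_eq_add_mul hg
  obtain ⟨g₂, hg₂, hgg₂⟩ := exists_contDiff_eq_add_mul hg₁
  have hjet := ((HasTwoJet.const (f 0)).add (HasTwoJet.id.mul ((HasTwoJet.const (g 0)).add
    (HasTwoJet.id.mul (HasTwoJet.of_contDiff hg₁))))).congr
    (v := f) (Eventually.of_forall fun t ↦ by
      change f t = f 0 + t * (g 0 + t * g₁ t)
      rw [← hgg₁, ← hfg])
  rw [hjet.deriv_eq, hjet.deriv_deriv_eq] at h
  refine ⟨16 / 9 * g 0, fun t ↦ -(3 / 4) * g₂ t, contDiff_const.mul hg₂, fun t ↦ ?_⟩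
  have e : g₁ 0 = -(16 / 9) * g 0 ^ 2 := by linear_combination h / 18
  rw [hfg, hgg₁, hgg₂, h0, e]
  ring

namespace EquiAffineStructure

variable {M : Type*} [TopologicalSpace M] [ChartedSpace Plane M] [IsManifold (𝓡 2) ∞ M]

/-- If `[γ', γ'']` is the linear function `(4/3)³ t`, then the parameter is the 3/4-arclength. -/
lemma arclength_of_bracket_eq {A : EquiAffineStructure M} {γ : ℝ → M} {δ : ℝ}
    (h : ∀ t ∈ Ioo (-δ) δ, A.bracket γ 1 2 t = 64 / 27 * t) {t : ℝ} (ht : t ∈ Ioo (-δ) δ) :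
    A.arclength γ t = t * |t| ^ (1 / 3 : ℝ) := by
  have hδ : 0 < δ := by linarith [ht.1, ht.2]
  have hk : (64 / 27 : ℝ) ^ (1 / 3 : ℝ) = 4 / 3 := by
    rw [show (64 / 27 : ℝ) = (4 / 3) ^ (3 : ℕ) by norm_num, ← Real.rpow_natCast,
      ← Real.rpow_mul (by norm_num)]
    norm_num
  have : A.arclength γ t = ∫ u in (0 : ℝ)..t, |u| ^ (1 / 3 : ℝ) * (4 / 3) := by
    refine intervalIntegral.integral_congr fun u hu ↦ ?_
    have hu' : u ∈ Ioo (-δ) δ :=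
      (ordConnected_Ioo.uIcc_subset ⟨neg_lt_zero.2 hδ, hδ⟩ ht) hu
    simp only [h u hu']
    rw [abs_mul, Real.mul_rpow (abs_nonneg _) (abs_nonneg _),
      abs_of_pos (by norm_num : (0 : ℝ) < 64 / 27), hk, mul_comm]
  rw [this, integral_cbrt_mul_eq (fun _ ↦ 4 / 3), intervalIntegral.integral_mul_const,
    integral_cbrt]
  ring

lemma threeQuarterArclength_of_bracket_eq {A : EquiAffineStructure M} {γ : ℝ → M} {δ : ℝ}
    (h : ∀ t ∈ Ioo (-δ) δ, A.bracket γ 1 2 t = 64 / 27 * t) {t : ℝ} (ht : t ∈ Ioo (-δ) δ) :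
    A.threeQuarterArclength γ t = t := by
  rw [threeQuarterArclength, arclength_of_bracket_eq h ht, abs_mul,
    abs_of_nonneg (Real.rpow_nonneg (abs_nonneg t) _),
    ← Real.rpow_one_add' (abs_nonneg t) (by norm_num), ← Real.rpow_mul (abs_nonneg t)]
  norm_num
  exact sign_mul_abs_self t

/-- Every curvature function with the right two-jet at the origin is realized by a curve with a
generic inflection point. -/
theorem exists_isGenericInflection_normalizedCurvature_eq [T2Space M] [Nonempty M]
    (A : EquiAffineStructure M) (f : ℝ → ℝ) (a : ℝ) (ha : 0 < a)
    (hf : ContDiffOn ℝ ∞ f (Ioo (-a) a)) (h0 : f 0 = -(5 / 16))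
    (hrel : 32 * deriv f 0 ^ 2 + 9 * iteratedDeriv 2 f 0 = 0) :
    ∃ (γ : ℝ → M) (δ : ℝ), δ ≤ a ∧ A.IsGenericInflection γ δ ∧
      ∀ t ∈ Ioo (-δ) δ, A.threeQuarterArclength γ t = t ∧
        (t ≠ 0 → A.bracket γ 1 2 t ≠ 0 ∧ A.normalizedCurvature γ t = f t) := by
  obtain ⟨F, hF, hFf⟩ := exists_contDiff_eventuallyEq ha hf
  obtain ⟨ε₁, hε₁, hFf₁⟩ := exists_Ioo_of_eventually hFf
  rw [iteratedDeriv_two_eq, ← hFf.deriv_eq, ← hFf.deriv.deriv_eq] at hrel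
  obtain ⟨c, x, hx, hFx⟩ := exists_contDiff_structure_coefficient hF
    (hFf.self_of_nhds.trans h0) hrel
  obtain ⟨γ, E, ε, hε, hγ⟩ := A.exists_curve_of_structure_equations (a := fun _ ↦ c)
    (b := fun t ↦ 64 / 27 * t) contDiff_const (contDiff_const.mul contDiff_id) hx
  have hnhds : ∀ t ∈ Ioo (-ε) ε, ∀ᶠ u in 𝓝 t, u ∈ Ioo (-ε) ε :=
    fun t ht ↦ isOpen_Ioo.eventually_mem ht
  have hγs : ∀ t ∈ Ioo (-ε) ε, ∀ᶠ u in 𝓝 t, ContMDiffAt 𝓘(ℝ, ℝ) (𝓡 2) ∞ γ u :=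
    fun t ht ↦ (hnhds t ht).mono fun u hu ↦ (hγ u hu).1
  have d2 : ∀ t ∈ Ioo (-ε) ε, A.curveDeriv γ 2 t = c • velocity γ t + (64 / 27 * t) • E t :=
    fun t ht ↦ (hγ t ht).2.2.1
  have d3 : ∀ t ∈ Ioo (-ε) ε, A.curveDeriv γ 3 t
      = (c ^ 2 + 64 / 27 * t * x t) • velocity γ t + (64 / 27 : ℝ) • E t := by
    intro t ht
    obtain ⟨-, hE, hDv, hDE, -⟩ := hγ t ht
    have hv : SmoothAlongAt γ (velocity γ) t := smoothAlongAt_velocity (hγs t ht)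
    have hlin : HasDerivAt (fun u : ℝ ↦ 64 / 27 * u) (64 / 27) t := by
      simpa using (hasDerivAt_id t).const_mul (64 / 27 : ℝ)
    have hlin' : ContDiffAt ℝ ∞ (fun u : ℝ ↦ 64 / 27 * u) t :=
      (contDiff_const.mul contDiff_id).contDiffAt
    change A.covDerivAlong γ (A.curveDeriv γ 2) t = _
    rw [covDerivAlong_congr A ((hnhds t ht).mono d2),
      covDerivAlong_add A (hv.smul contDiffAt_const) (hE.smul hlin'),
      covDerivAlong_smul A (differentiableAt_const c) hv,
      covDerivAlong_smul A hlin.differentiableAt hE, hDv, hDE, hlin.deriv, deriv_const]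
    module
  have b12 : ∀ t ∈ Ioo (-ε) ε, A.bracket γ 1 2 t = 64 / 27 * t := by
    intro t ht
    rw [bracket, d2 t ht]
    simp only [curveDeriv, map_add, map_smul, A.alternating, (hγ t ht).2.2.2.2, smul_eq_mul]
    ring
  have b13 : ∀ t ∈ Ioo (-ε) ε, A.bracket γ 1 3 t = 64 / 27 := by
    intro t ht
    rw [bracket, d3 t ht]
    simp only [curveDeriv, map_add, map_smul, A.alternating, (hγ t ht).2.2.2.2, smul_eq_mul]
    ring
  have b23 : ∀ t ∈ Ioo (-ε) ε, A.bracket γ 2 3 t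
      = 64 / 27 * c - 64 / 27 * t * (c ^ 2 + 64 / 27 * t * x t) := by
    intro t ht
    rw [bracket, d2 t ht, d3 t ht]
    simp only [map_add, map_smul, add_apply, smul_apply, A.alternating, (hγ t ht).2.2.2.2,
      smul_eq_mul, A.area_swap (velocity γ t) (E t)]
    ring
  -- `[γ', γ⁽³⁾]` is constant, and its derivative is `[γ', γ⁽⁴⁾] + [γ'', γ⁽³⁾]`; no fourth
  -- derivative has to be computed.
  have b14 : ∀ t ∈ Ioo (-ε) ε, A.bracket γ 1 4 t = -A.bracket γ 2 3 t := by
    intro t ht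
    have h1 := hasDerivAt_bracket_one_three A (hγs t ht)
    have h2 : HasDerivAt (A.bracket γ 1 3) 0 t :=
      (hasDerivAt_const t (64 / 27 : ℝ)).congr_of_eventuallyEq ((hnhds t ht).mono b13)
    linarith [h1.unique h2]
  set δ := min ε (min ε₁ a) with hδ
  have hδε : ∀ t ∈ Ioo (-δ) δ, t ∈ Ioo (-ε) ε := fun t ht ↦
    ⟨by linarith [ht.1, min_le_left ε (min ε₁ a)], ht.2.trans_le (min_le_left _ _)⟩
  have hδε₁ : ∀ t ∈ Ioo (-δ) δ, t ∈ Ioo (-ε₁) ε₁ := fun t ht ↦ by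
    have : δ ≤ ε₁ := (min_le_right _ _).trans (min_le_left _ _)
    exact ⟨by linarith [ht.1], ht.2.trans_le this⟩
  have hδ0 : 0 < δ := lt_min hε (lt_min hε₁ ha)
  have h0ε : (0 : ℝ) ∈ Ioo (-ε) ε := ⟨neg_lt_zero.2 hε, hε⟩
  refine ⟨γ, δ, (min_le_right _ _).trans (min_le_right _ _), ⟨hδ0, ?_, ?_, ?_, ?_⟩, ?_⟩
  · exact fun t ht ↦ (hγ t (hδε t ht)).1.contMDiffWithinAt
  · intro t ht hv
    have := (hγ t (hδε t ht)).2.2.2.2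
    rw [hv, map_zero] at this
    exact zero_ne_one this
  · rw [b12 0 h0ε, mul_zero]
  · rw [b13 0 h0ε]; norm_num
  · intro t ht
    have htε := hδε t ht
    refine ⟨threeQuarterArclength_of_bracket_eq b12 htε, fun ht0 ↦ ⟨?_, ?_⟩⟩
    · rw [b12 t htε]; exact mul_ne_zero (by norm_num) ht0
    · have htp : 0 < |t| := abs_pos.2 ht0
      have hs : 0 < |t| ^ (1 / 3 : ℝ) := Real.rpow_pos_of_pos htp _
      have hs3 : (|t| ^ (1 / 3 : ℝ)) ^ 3 = |t| := by
        rw [← Real.rpow_natCast, ← Real.rpow_mul htp.le]; norm_num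
      have hs8 : |t| ^ (8 / 3 : ℝ) = (|t| ^ (1 / 3 : ℝ)) ^ 2 * t ^ 2 := by
        have : |t| ^ (8 / 3 : ℝ) = (|t| ^ (1 / 3 : ℝ)) ^ 8 := by
          rw [← Real.rpow_natCast, ← Real.rpow_mul htp.le]; norm_num
        rw [this, ← sq_abs t]
        linear_combination (|t| ^ (1 / 3 : ℝ)) ^ 2 * ((|t| ^ (1 / 3 : ℝ)) ^ 3 + |t|) * hs3
      have hk : (64 / 27 : ℝ) ^ (8 / 3 : ℝ) = (4 / 3) ^ 8 := by
        rw [show (64 / 27 : ℝ) = (4 / 3) ^ (3 : ℕ) by norm_num, ← Real.rpow_natCast,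
          ← Real.rpow_mul (by norm_num), ← Real.rpow_natCast]
        norm_num
      rw [← hFf₁ t (hδε₁ t ht), hFx, ← b23 t htε, normalizedCurvature, curvature,
        arclength_of_bracket_eq b12 htε, b14 t htε, b12 t htε, b13 t htε, abs_mul,
        Real.mul_rpow (abs_nonneg _) (abs_nonneg _), abs_of_pos (by norm_num : (0 : ℝ) < 64 / 27),
        hk, hs8]
      -- All fractional powers are now powers of `s`, so the remaining identity is rational in `s`,
      -- `t` and `[γ'', γ⁽³⁾]`.
      generalize |t| ^ (1 / 3 : ℝ) = s at hs
      field_simp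
      ring

end EquiAffineStructure

end

theorem theorem4p7 {M : Type*} [TopologicalSpace M] [ChartedSpace Plane M]
    [IsManifold (𝓡 2) ∞ M] [T2Space M] [Nonempty M] (A : EquiAffineStructure M) :
    -- every generic inflection point
    (∀ (γ : ℝ → M) (δ : ℝ), A.IsGenericInflection γ δ →
      ∃ ε : ℝ, 0 < ε ∧ ε ≤ δ ∧
        (∀ t ∈ Ioo (-ε) ε, t ≠ 0 → A.bracket γ 1 2 t ≠ 0) ∧
        -- the 3/4-arclength is a smooth coordinate near `t = 0`
        ∃ τ : OpenPartialHomeomorph ℝ ℝ, τ.source = Ioo (-ε) ε ∧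
          EqOn τ (A.threeQuarterArclength γ) (Ioo (-ε) ε) ∧
          ContDiffOn ℝ ∞ τ τ.source ∧ ContDiffOn ℝ ∞ τ.symm τ.target ∧
          -- the normalized curvature is a smooth function `f` of `t` and `F` of `τ`
          ∃ f F : ℝ → ℝ, ContDiffOn ℝ ∞ f (Ioo (-ε) ε) ∧ ContDiffOn ℝ ∞ F τ.target ∧
            (∀ t ∈ Ioo (-ε) ε, t ≠ 0 → f t = A.normalizedCurvature γ t) ∧
            (∀ t ∈ Ioo (-ε) ε, F (τ t) = f t) ∧
            -- the relation in an arbitrary parameter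
            -(9 / 7) * ((A.bracket γ 1 4 0 + A.bracket γ 2 3 0) / A.bracket γ 1 3 0) * deriv f 0
              + 32 * deriv f 0 ^ 2 + 9 * iteratedDeriv 2 f 0 = 0 ∧
            f 0 = -(5 / 16) ∧
            Tendsto (A.normalizedCurvature γ) (𝓝[≠] 0) (𝓝 (-(5 / 16))) ∧
            Tendsto (fun t ↦ (A.normalizedCurvature γ t + 5 / 16) / A.threeQuarterArclength γ t)
              (𝓝[≠] 0) (𝓝 (-(3 * (3 : ℝ) ^ (1 / 4 : ℝ) / (28 * √2))
                * A.inflectionalCurvature γ 0)) ∧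
            -- the relation in the parameter `τ`
            32 * deriv F 0 ^ 2 + 9 * iteratedDeriv 2 F 0 = 0 ∧
            -- if `t = τ`, the coefficient in the general relation vanishes
            ((∀ᶠ t in 𝓝 (0 : ℝ), A.threeQuarterArclength γ t = t) →
              A.bracket γ 1 4 0 + A.bracket γ 2 3 0 = 0 ∧
              32 * deriv f 0 ^ 2 + 9 * iteratedDeriv 2 f 0 = 0)) ∧
    -- the converse realization
    (∀ (f : ℝ → ℝ) (a : ℝ), 0 < a → ContDiffOn ℝ ∞ f (Ioo (-a) a) → f 0 = -(5 / 16) →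
      32 * deriv f 0 ^ 2 + 9 * iteratedDeriv 2 f 0 = 0 →
      ∃ (γ : ℝ → M) (δ : ℝ), δ ≤ a ∧ A.IsGenericInflection γ δ ∧
        ∀ t ∈ Ioo (-δ) δ, A.threeQuarterArclength γ t = t ∧
          (t ≠ 0 → A.bracket γ 1 2 t ≠ 0 ∧ A.normalizedCurvature γ t = f t)) :=
  ⟨A.normalizedCurvature_of_isGenericInflection,
    A.exists_isGenericInflection_normalizedCurvature_eq⟩
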